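/- For $n\ge 1$ let $X_n,Y_n$ be independent random matrices from the Gaussian Unitary Ensemble of size $n$, normalised so that the diagonal entries are real standard Gaussians, the entries above the diagonal are complex Gaussians whose real and imaginary parts are independent centred Gaussians of variance $1/2$, all of these are independent, and the matrix is Hermitian. For $t\in[0,1]$ let \[A_{n,t}=\sqrt{\tfrac{1+t}{2}}\,X_n+i\sqrt{\tfrac{1-t}{2}}\,Y_n\] (the Elliptic Ginibre Ensemble), let $\mathbb D=\{z\in\mathbb C:|z|<1\}$, and for $z\in\mathbb D$ set \[f_{n,t}(z)=\det\Bigl(1+tz^2-\frac{z}{\sqrt n}A_{n,t}\Bigr)\,e^{-ntz^2/2}.\] Fix $t\in(0,1]$. Then: 1. For every $n\ge 1$ and $z\in\mathbb D$ the second moment $\mathbb E[|f_{n,t}(z)|^2]$ is finite, and there is a continuous function $\mathcal F:\mathbb D\setminus\{0\}\to(0,\infty)$ such that $\mathbb E[|f_{n,t}(z)|^2]\to\mathcal F(z)$ as $n\to\infty$, uniformly for $z$ in any compact subset of $\mathbb D\setminus\{0\}$. 2. For every $r\in[0,1)$ there is a constant $C_r>0$ such that, for every $n\ge 1$, \[\mathbb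 E\Bigl[\sup_{|z|\le r}|f_{n,t}(z)|^2\Bigr]\le C_r .\] -/

import Mathlib

open MeasureTheory ProbabilityTheory Filter Topology

noncomputable section

namespace EllipticGinibre

/-- The product (entrywise Borel) sigma-algebra on complex `n × n` matrices. -/
instance matrixMeasurableSpace (n : ℕ) : MeasurableSpace (Matrix (Fin n) (Fin n) ℂ) :=
  inferInstanceAs (MeasurableSpace (Fin n → Fin n → ℂ))

/-- The `n × n` Hermitian matrix built from `n²` real numbers: the diagonal entries are `g i i`,
and for `i < j` the entry `(i, j)` is `(g i j + i g j i) / √2`. -/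
def hermitianOfReal (n : ℕ) (g : Fin n → Fin n → ℝ) : Matrix (Fin n) (Fin n) ℂ :=
  Matrix.of fun i j =>
    if i < j then ((g i j : ℂ) + Complex.I * (g j i : ℂ)) / (√2 : ℝ)
    else if j < i then ((g j i : ℂ) - Complex.I * (g i j : ℂ)) / (√2 : ℝ)
    else (g i i : ℂ)

/-- The law of the Gaussian Unitary Ensemble of size `n`, normalised so that every entry has
`E |X i j|² = 1`: the diagonal entries are standard real Gaussians, the entries above the diagonal
are standard complex Gaussians (independent real and imaginary parts of variance `1/2`), and all
of these are independent. -/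
def gueLaw (n : ℕ) : Measure (Matrix (Fin n) (Fin n) ℂ) :=
  (Measure.pi fun _ : Fin n => Measure.pi fun _ : Fin n => gaussianReal 0 1).map
    (hermitianOfReal n)

/-- The matrix `√((1+t)/2) X + i √((1-t)/2) Y`. -/
def ellipticCombination (n : ℕ) (t : ℝ)
    (p : Matrix (Fin n) (Fin n) ℂ × Matrix (Fin n) (Fin n) ℂ) : Matrix (Fin n) (Fin n) ℂ :=
  ((√((1 + t) / 2) : ℝ) : ℂ) • p.1 + (Complex.I * ((√((1 - t) / 2) : ℝ) : ℂ)) • p.2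

/-- The law of the Elliptic Ginibre Ensemble of size `n` with parameter `t`: the law of
`√((1+t)/2) X + i √((1-t)/2) Y` for `X`, `Y` independent with the GUE law. -/
def egeLaw (n : ℕ) (t : ℝ) : Measure (Matrix (Fin n) (Fin n) ℂ) :=
  ((gueLaw n).prod (gueLaw n)).map (ellipticCombination n t)

/-- The normalised characteristic polynomial
`f_{n,t}(z) = det (1 + t z² - (z / √n) A) exp (- n t z² / 2)` of the matrix `A`. -/
def normCharPoly (n : ℕ) (t : ℝ) (A : Matrix (Fin n) (Fin n) ℂ) (z : ℂ) : ℂ :=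
  ((1 + (t : ℂ) * z ^ 2) • (1 : Matrix (Fin n) (Fin n) ℂ) - (z / ((√(n : ℝ) : ℝ) : ℂ)) • A).det *
    Complex.exp (-((n : ℂ) * (t : ℂ) * z ^ 2) / 2)

lemma measurable_hermitianOfReal (n : ℕ) : Measurable (hermitianOfReal n) := by
  refine measurable_pi_lambda _ fun i => measurable_pi_lambda _ fun j => ?_
  simp only [hermitianOfReal, Matrix.of_apply]
  split_ifs <;> fun_prop

lemma measurable_ellipticCombination (n : ℕ) (t : ℝ) : Measurable (ellipticCombination n t) := by
  refine measurable_pi_lambda _ fun i => measurable_pi_lambda _ fun j => ?_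
  have h : Measurable fun M : Matrix (Fin n) (Fin n) ℂ => M i j :=
    (measurable_pi_apply (X := fun _ : Fin n => ℂ) j).comp
      (measurable_pi_apply (X := fun _ : Fin n => Fin n → ℂ) i)
  exact ((h.comp measurable_fst).const_mul _).add ((h.comp measurable_snd).const_mul _)

instance isProbabilityMeasure_gueLaw (n : ℕ) : IsProbabilityMeasure (gueLaw n) :=
  Measure.isProbabilityMeasure_map (measurable_hermitianOfReal n).aemeasurable

instance isProbabilityMeasure_egeLaw (n : ℕ) (t : ℝ) : IsProbabilityMeasure (egeLaw n t) :=
  Measure.isProbabilityMeasure_map (measurable_ellipticCombination n t).aemeasurable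

end EllipticGinibre

end

noncomputable section

namespace EllipticGinibre

/-! The second moment of a characteristic polynomial has a closed form. Write `H_k` for the Hermite
polynomial of variance `t`. Then `E|det(u - A)|² = ∑_{k ≤ n} (n!/k!) |H_k(u)|²`
(`integral_normSq_charpoly`, `integral_normSq_det`). To see this, expand the determinant and its
conjugate over pairs of permutations. The expectation factors over the diagonal entries and the
pairs of opposite off-diagonal entries, because these blocks are independent. What remains is a
signed sum of explicit block moments, `covSum`. In it, `t` and `u` are kept separate for the
determinant and for its conjugate, giving four formal variables `t, t', u, v`.

As a polynomial in these variables, `covSum` solves `2∂_t = -∂_u²` and `2∂_{t'} = -∂_v²`.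
Differentiating in `t` singles out a 2-cycle `(i j)`, and differentiating twice in `u` singles out
two fixed points. Composing with the transposition of `i` and `j` exchanges the two situations and
flips the sign (`permSum_heat`). The Hermite kernel solves the same equations. At `t = t' = 0` only
equal permutations contribute, and both sides become the same polynomial in `uv` (`covSum_zero`). A
polynomial solution is determined by its value at time zero (`eq_zero_of_heat`), so the two agree.

Put `a = t z²`. After rescaling, the Hermite factors are the Taylor coefficients, times `k!`, of the
entire function `exp(n(w - a(w-1)²/2))`, so Cauchy's formula expresses them as contour integrals.
For the index `k = n - j` with `j` fixed, the saddle point lies at `w = 1`. The rescaled integral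
becomes Gaussian, and the `j`-th term of the second moment tends to `|z|^{2j} / |1 - t z²|`. Summing
over `j` gives the limit `1 / ((1 - |z|²) |1 - t z²|)`. The exchange of limit and sum rests on a
summable majorant: a geometric bound from the unit circle when `j` is not too large, and a bound
`O(n |z|^{2j})` from an adapted circle when `j` is comparable to `n` (`momentTerm_le_momentBound`).
Limits are taken jointly in `n` and `z`, which yields uniformity on compact sets.

The supremum bound follows since `f` is entire in `z`: Cauchy's formula for `f²` bounds `|f|²` on a
disc by its mean over a larger circle, and Tonelli's theorem reduces to the second moment on that
circle. -/

/-- The monic Hermite polynomials with variance parameter `t`, evaluated at `u`; their exponential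
generating function is `exp (u s - t s² / 2)`. -/
def hermiteVar {R : Type*} [CommRing R] (t u : R) : ℕ → R
  | 0 => 1
  | 1 => u
  | k + 2 => u * hermiteVar t u (k + 1) - (k + 1) * t * hermiteVar t u k

/-! ### Hermite polynomials over a commutative ring, and derivations acting on them. -/

section Hermite

variable {R S 𝕜 : Type*} [CommRing R] [CommRing S] [CommRing 𝕜] [Algebra 𝕜 R]

lemma map_hermiteVar (f : R →+* S) (t u : R) (k : ℕ) :
    f (hermiteVar t u k) = hermiteVar (f t) (f u) k := by
  induction k using Nat.strong_induction_on with
  | _ k ih =>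
    match k with
    | 0 => simp [hermiteVar]
    | 1 => simp [hermiteVar]
    | k + 2 => simp [hermiteVar, ih k (by omega), ih (k + 1) (by omega)]

lemma hermiteVar_zero_left (u : R) (k : ℕ) : hermiteVar 0 u k = u ^ k := by
  induction k using Nat.strong_induction_on with
  | _ k ih =>
    match k with
    | 0 => simp [hermiteVar]
    | 1 => simp [hermiteVar]
    | k + 2 => simp [hermiteVar, ih (k + 1) (by omega)]; ring

/-- Homogeneity with `u` of weight 1 and `t` of weight 2. It later absorbs the factor `z √n` into
the arguments. -/
lemma hermiteVar_scale (c t u : R) (k : ℕ) :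
    hermiteVar (c ^ 2 * t) (c * u) k = c ^ k * hermiteVar t u k := by
  induction k using Nat.strong_induction_on with
  | _ k ih =>
    match k with
    | 0 => simp [hermiteVar]
    | 1 => simp [hermiteVar]
    | k + 2 => simp only [hermiteVar, ih k (by omega), ih (k + 1) (by omega)]; ring

/-- A derivation that kills `t` and sends `u` to `1` lowers the index. -/
lemma derivation_hermiteVar_right (D : Derivation 𝕜 R R) {t u : R} (ht : D t = 0) (hu : D u = 1)
    (k : ℕ) : D (hermiteVar t u (k + 1)) = (k + 1) * hermiteVar t u k := by
  induction k using Nat.strong_induction_on with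
  | _ k ih =>
    match k with
    | 0 => simp [hermiteVar, hu]
    | 1 =>
      simp only [hermiteVar]
      simp [hu, ht]; ring
    | k + 2 =>
      have h1 := ih (k + 1) (by omega)
      have h2 := ih k (by omega)
      have hk : D ((k : R)) = 0 := D.map_natCast k
      have e1 : hermiteVar t u (k + 2) = u * hermiteVar t u (k + 1)
        - ((k : R) + 1) * t * hermiteVar t u k := rfl
      have e2 : hermiteVar t u (k + 2 + 1) = u * hermiteVar t u (k + 2)
        - (((k + 1 : ℕ) : R) + 1) * t * hermiteVar t u (k + 1) := rfl
      rw [e2]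
      simp only [map_sub, Derivation.leibniz, smul_eq_mul, hu, ht, map_add, Nat.cast_add,
        Nat.cast_one, hk, Derivation.map_one_eq_zero, h1, h2]
      rw [e1]
      push_cast
      ring

/-- A derivation that kills `u` and sends `t` to `1` acts as minus half the second derivative. -/
lemma derivation_hermiteVar_left (D : Derivation 𝕜 R R) {t u : R} (ht : D t = 1) (hu : D u = 0)
    (k : ℕ) : 2 * D (hermiteVar t u (k + 2)) = -((k + 1) * (k + 2) * hermiteVar t u k) := by
  induction k using Nat.strong_induction_on with
  | _ k ih =>
    match k with
    | 0 =>
      simp only [hermiteVar]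
      simp [hu, ht]
    | 1 =>
      simp only [hermiteVar]
      simp [hu, ht]; ring
    | k + 2 =>
      have h1 := ih (k + 1) (by omega)
      have h2 := ih k (by omega)
      have hk : D ((k : R)) = 0 := D.map_natCast k
      have e1 : hermiteVar t u (k + 2) = u * hermiteVar t u (k + 1)
        - ((k : R) + 1) * t * hermiteVar t u k := rfl
      have e2 : hermiteVar t u (k + 2 + 2) = u * hermiteVar t u (k + 1 + 2)
        - (((k + 2 : ℕ) : R) + 1) * t * hermiteVar t u (k + 2) := rfl
      have hD2 : D (2 : R) = 0 := by exact_mod_cast D.map_natCast 2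
      rw [e2]
      simp only [map_sub, Derivation.leibniz, smul_eq_mul, hu, ht, map_add, Nat.cast_add,
        hk, Derivation.map_one_eq_zero, Nat.cast_ofNat, hD2]
      push_cast at h1 ⊢
      linear_combination u * h1 - ((k : R) + 3) * t * h2 + ((k : R) + 2) * (k + 3) * e1

end Hermite

/-! ### The heat equation for signed sums over permutations. -/

section PermSum

variable {ι : Type*} [Fintype ι] [LinearOrder ι] {R 𝕜 : Type*} [CommRing R] [CommRing 𝕜]
  [Algebra 𝕜 R]

/-- The pairs `(i, j)` with `i < j`. -/
def upperPairs (ι : Type*) [Fintype ι] [LinearOrder ι] : Finset (ι × ι) :=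
  Finset.univ.filter fun p => p.1 < p.2

lemma mem_upperPairs {p : ι × ι} : p ∈ upperPairs ι ↔ p.1 < p.2 := by simp [upperPairs]

/-- The contribution of the diagonal entry `(i, i)` to the term of the permutation `σ`. -/
def diagFactor (u : R) (x₀ x₁ : ι → R) (σ : Equiv.Perm ι) (i : ι) : R :=
  if σ i = i then u * x₀ i + x₁ i else x₀ i

/-- The contribution of the pair of entries `(i, j)`, `(j, i)` to the term of `σ`. -/
def pairFactor (t : R) (y₀ y₁ y₂ y₃ : ι × ι → R) (σ : Equiv.Perm ι) (p : ι × ι) : R :=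
  if σ p.1 = p.2 then (if σ p.2 = p.1 then t * y₀ p + y₃ p else y₁ p)
  else (if σ p.2 = p.1 then y₂ p else y₀ p)

/-- The signed sum over permutations of products of diagonal and pair contributions. -/
def permSum (t u : R) (x₀ x₁ : ι → R) (y₀ y₁ y₂ y₃ : ι × ι → R) : R :=
  ∑ σ : Equiv.Perm ι, ((Equiv.Perm.sign σ : ℤ) : R) *
    ((∏ i, diagFactor u x₀ x₁ σ i) * ∏ p ∈ upperPairs ι, pairFactor t y₀ y₁ y₂ y₃ σ p)

lemma derivation_prod {α : Type*} [DecidableEq α] (D : Derivation 𝕜 R R) (s : Finset α)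
    (f : α → R) : D (∏ i ∈ s, f i) = ∑ i ∈ s, (∏ j ∈ s.erase i, f j) * D (f i) := by
  induction s using Finset.induction_on with
  | empty => simp
  | insert a s ha ih =>
    rw [Finset.prod_insert ha, Derivation.leibniz, Finset.sum_insert ha, Finset.erase_insert ha,
      ih, smul_eq_mul, smul_eq_mul, Finset.mul_sum, add_comm]
    congr 1
    refine Finset.sum_congr rfl fun i hi => ?_
    have hia : a ≠ i := fun h => ha (h ▸ hi)
    rw [Finset.erase_insert_of_ne hia, Finset.prod_insert (by simp [ha])]
    ring

lemma sum_offDiag_symm (g : ι → ι → R) (hg : ∀ i j, g i j = g j i) :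
    ∑ i, ∑ j ∈ Finset.univ.erase i, g i j = 2 * ∑ p ∈ upperPairs ι, g p.1 p.2 := by
  have h1 : ∑ i, ∑ j ∈ Finset.univ.erase i, g i j =
      ∑ i, ∑ j, ((if i < j then g i j else 0) + (if j < i then g j i else 0)) := by
    refine Finset.sum_congr rfl fun i _ => ?_
    rw [← Finset.sum_erase (s := Finset.univ) (a := i)
      (f := fun j => (if i < j then g i j else 0) + (if j < i then g j i else 0)) (by simp)]
    refine Finset.sum_congr rfl fun j hj => ?_
    rcases lt_trichotomy i j with h | h | h
    · simp [h, not_lt.2 h.le]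
    · simp [h] at hj
    · simp [h, not_lt.2 h.le, hg]
  have h2 : ∑ i, ∑ j, (if i < j then g i j else 0) = ∑ p ∈ upperPairs ι, g p.1 p.2 := by
    rw [upperPairs, Finset.sum_filter, Fintype.sum_prod_type]
  rw [h1]
  simp only [Finset.sum_add_distrib]
  rw [h2, Finset.sum_comm, h2]
  ring

section heat

variable {t u : R} {x₀ x₁ : ι → R} {y₀ y₁ y₂ y₃ : ι × ι → R}

lemma diagFactor_mul_swap_of_ne (σ : Equiv.Perm ι) {i j k : ι} (hi : k ≠ i) (hj : k ≠ j) :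
    diagFactor u x₀ x₁ (σ * Equiv.swap i j) k = diagFactor u x₀ x₁ σ k := by
  simp [diagFactor, Equiv.swap_apply_of_ne_of_ne hi hj]

/-- Both permutations preserve `{i, j}`, so the only off-diagonal entries on which they differ are
`(i, j)` and `(j, i)`. -/
lemma pairFactor_mul_swap (σ : Equiv.Perm ι) {i j : ι} (hij : i < j) (hi : σ i = i) (hj : σ j = j)
    {p : ι × ι} (hp : p.1 < p.2) (hne : p ≠ (i, j)) :
    pairFactor t y₀ y₁ y₂ y₃ (σ * Equiv.swap i j) p = pairFactor t y₀ y₁ y₂ y₃ σ p := by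
  obtain ⟨a, b⟩ := p
  have hab : a ≠ b := ne_of_lt hp
  have key : ∀ a b : ι, a ≠ b → ¬ (a = i ∧ b = j) → ¬ (a = j ∧ b = i) →
      (((σ * Equiv.swap i j) a = b) ↔ σ a = b) := by
    intro a b hab h1 h2
    by_cases hai : a = i
    · subst hai
      simp only [Equiv.Perm.mul_apply, Equiv.swap_apply_left, hj, hi]
      exact ⟨fun h => absurd ⟨rfl, h.symm⟩ h1, fun h => absurd h hab⟩
    · by_cases haj : a = j
      · subst haj
        simp only [Equiv.Perm.mul_apply, Equiv.swap_apply_right, hj, hi]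
        exact ⟨fun h => absurd ⟨rfl, h.symm⟩ h2, fun h => absurd h hab⟩
      · simp [Equiv.swap_apply_of_ne_of_ne hai haj]
  have hn1 : ¬ (a = i ∧ b = j) := fun h => hne (by simp [h.1, h.2])
  have hn2 : ¬ (a = j ∧ b = i) := fun h => by
    simp only [h.1, h.2] at hp
    exact absurd hij (not_lt.2 hp.le)
  simp only [pairFactor, key a b hab hn1 hn2,
    key b a hab.symm (fun h => hn2 ⟨h.2, h.1⟩) (fun h => hn1 ⟨h.2, h.1⟩)]

/-- `permSum` solves the heat equation `2 ∂ₜ = - ∂ᵤ²`. -/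
lemma permSum_heat (Dt Du : Derivation 𝕜 R R) (htt : Dt t = 1) (htu : Dt u = 0) (hut : Du t = 0)
    (huu : Du u = 1) (tx₀ : ∀ i, Dt (x₀ i) = 0) (tx₁ : ∀ i, Dt (x₁ i) = 0)
    (ty₀ : ∀ p, Dt (y₀ p) = 0) (ty₁ : ∀ p, Dt (y₁ p) = 0) (ty₂ : ∀ p, Dt (y₂ p) = 0)
    (ty₃ : ∀ p, Dt (y₃ p) = 0)
    (ux₀ : ∀ i, Du (x₀ i) = 0) (ux₁ : ∀ i, Du (x₁ i) = 0)
    (uy₀ : ∀ p, Du (y₀ p) = 0) (uy₁ : ∀ p, Du (y₁ p) = 0) (uy₂ : ∀ p, Du (y₂ p) = 0)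
    (uy₃ : ∀ p, Du (y₃ p) = 0) :
    2 * Dt (permSum t u x₀ x₁ y₀ y₁ y₂ y₃) = -Du (Du (permSum t u x₀ x₁ y₀ y₁ y₂ y₃)) := by
  have dtx : ∀ σ i, Dt (diagFactor u x₀ x₁ σ i) = 0 := fun σ i => by
    simp only [diagFactor]; split_ifs <;> simp [tx₀, tx₁, htu]
  have dux : ∀ σ i, Du (diagFactor u x₀ x₁ σ i) = if σ i = i then x₀ i else 0 := fun σ i => by
    simp only [diagFactor]; split_ifs <;> simp [ux₀, ux₁, huu]
  have duy : ∀ σ p, Du (pairFactor t y₀ y₁ y₂ y₃ σ p) = 0 := fun σ p => by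
    simp only [pairFactor]; split_ifs <;> simp [uy₀, uy₁, uy₂, uy₃, hut]
  have dty : ∀ σ p, Dt (pairFactor t y₀ y₁ y₂ y₃ σ p) =
      if σ p.1 = p.2 ∧ σ p.2 = p.1 then y₀ p else 0 := fun σ p => by
    simp only [pairFactor]; split_ifs <;> simp_all
  have hDprod0 : ∀ (D : Derivation 𝕜 R R) {α : Type _} (s : Finset α) (f : α → R),
      (∀ i, D (f i) = 0) → D (∏ i ∈ s, f i) = 0 := by
    classical
    intro D α s f hf
    rw [derivation_prod]; simp [hf]
  have hcast : ∀ (D : Derivation 𝕜 R R) (z : ℤ), D ((z : ℤ) : R) = 0 := fun D z =>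
    D.map_intCast z
  -- `A p σ` is the `t`-derivative falling on the pair `p`, nonzero only if `σ` swaps the two points
  -- of `p`. `B σ i j` below is the part of the second `u`-derivative falling on the fixed points
  -- `i` and `j`.
  set A : ι × ι → Equiv.Perm ι → R := fun p σ => ((Equiv.Perm.sign σ : ℤ) : R) *
    ((∏ i, diagFactor u x₀ x₁ σ i) * ((∏ q ∈ (upperPairs ι).erase p,
      pairFactor t y₀ y₁ y₂ y₃ σ q) * if σ p.1 = p.2 ∧ σ p.2 = p.1 then y₀ p else 0)) with hA
  set B : Equiv.Perm ι → ι → ι → R := fun σ i j => 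
    (∏ k ∈ (Finset.univ.erase i).erase j, diagFactor u x₀ x₁ σ k) *
      ((if σ j = j then x₀ j else 0) * (if σ i = i then x₀ i else 0)) with hB
  have hDt : Dt (permSum t u x₀ x₁ y₀ y₁ y₂ y₃) = ∑ p ∈ upperPairs ι, ∑ σ, A p σ := by
    rw [permSum, map_sum, Finset.sum_comm]
    refine Finset.sum_congr rfl fun σ _ => ?_
    rw [Derivation.leibniz, hcast, Derivation.leibniz, hDprod0 Dt _ _ (dtx σ), derivation_prod]
    simp only [smul_eq_mul, mul_zero, add_zero, dty, Finset.mul_sum, hA]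
  have hDu : Du (Du (permSum t u x₀ x₁ y₀ y₁ y₂ y₃)) = 2 * ∑ p ∈ upperPairs ι, ∑ σ : Equiv.Perm ι,
      ((Equiv.Perm.sign σ : ℤ) : R) * (B σ p.1 p.2 *
        ∏ q ∈ upperPairs ι, pairFactor t y₀ y₁ y₂ y₃ σ q) := by
    rw [permSum, map_sum, map_sum, Finset.sum_comm, Finset.mul_sum]
    refine Finset.sum_congr rfl fun σ _ => ?_
    rw [← Finset.mul_sum, ← Finset.sum_mul]
    have e1 : Du (Du (∏ i, diagFactor u x₀ x₁ σ i)) = 2 * ∑ p ∈ upperPairs ι, B σ p.1 p.2 := by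
      rw [derivation_prod, map_sum, ← sum_offDiag_symm (B σ)]
      · refine Finset.sum_congr rfl fun i _ => ?_
        have e0 : Du (if σ i = i then x₀ i else 0) = 0 := by split_ifs <;> simp [ux₀]
        rw [Derivation.leibniz, dux, e0, smul_zero, zero_add, derivation_prod, smul_eq_mul,
          Finset.mul_sum]
        refine Finset.sum_congr rfl fun j _ => ?_
        rw [dux, hB]; ring
      · intro i j
        simp only [hB, Finset.erase_right_comm (a := i)]
        ring
    have e2 : Du (∏ q ∈ upperPairs ι, pairFactor t y₀ y₁ y₂ y₃ σ q) = 0 :=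
      hDprod0 Du _ _ (duy σ)
    simp only [Derivation.leibniz, hcast, e2, smul_eq_mul, mul_zero, add_zero, zero_add, e1]
    ring
  rw [hDt, hDu, ← mul_neg, ← Finset.sum_neg_distrib]
  congr 1
  refine Finset.sum_congr rfl fun p hp => ?_
  obtain ⟨i, j⟩ := p
  have hij : i < j := mem_upperPairs.1 hp
  -- Composition with the transposition matches permutations having the 2-cycle `(i j)` with those
  -- fixing `i` and `j`. The weights agree because one `x₀` serves as the coefficient of `u` and as
  -- the weight of an unused diagonal entry, and one `y₀` likewise for `t` and an unused pair. Only
  -- the sign changes.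
  rw [← Equiv.sum_comp (Equiv.mulRight (Equiv.swap i j)), ← Finset.sum_neg_distrib]
  refine Finset.sum_congr rfl fun σ _ => ?_
  simp only [hA, hB, Equiv.coe_mulRight, Equiv.Perm.mul_apply, Equiv.swap_apply_left,
    Equiv.swap_apply_right]
  by_cases hi : σ i = i
  · by_cases hj : σ j = j
    · have hy : pairFactor t y₀ y₁ y₂ y₃ σ (i, j) = y₀ (i, j) := by
        simp [pairFactor, hi, hj, hij.ne, hij.ne']
      have hjm : j ∈ Finset.univ.erase i := by simp [hij.ne']
      rw [← Finset.mul_prod_erase Finset.univ _ (Finset.mem_univ i),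
        ← Finset.mul_prod_erase (Finset.univ.erase i) _ hjm,
        ← Finset.mul_prod_erase (upperPairs ι) (pairFactor t y₀ y₁ y₂ y₃ σ) hp, hy]
      have c1 : ∏ k ∈ (Finset.univ.erase i).erase j,
          diagFactor u x₀ x₁ (σ * Equiv.swap i j) k =
          ∏ k ∈ (Finset.univ.erase i).erase j, diagFactor u x₀ x₁ σ k :=
        Finset.prod_congr rfl fun k hk => by
          simp only [Finset.mem_erase] at hk
          exact diagFactor_mul_swap_of_ne σ hk.2.1 hk.1
      have c2 : ∏ q ∈ (upperPairs ι).erase (i, j),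
          pairFactor t y₀ y₁ y₂ y₃ (σ * Equiv.swap i j) q =
          ∏ q ∈ (upperPairs ι).erase (i, j), pairFactor t y₀ y₁ y₂ y₃ σ q :=
        Finset.prod_congr rfl fun q hq => by
          simp only [Finset.mem_erase] at hq
          exact pairFactor_mul_swap σ hij hi hj (mem_upperPairs.1 hq.2) hq.1
      have c3 : diagFactor u x₀ x₁ (σ * Equiv.swap i j) i = x₀ i := by
        simp [diagFactor, hj, hij.ne']
      have c4 : diagFactor u x₀ x₁ (σ * Equiv.swap i j) j = x₀ j := by
        simp [diagFactor, hi, hij.ne]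
      rw [c1, c2, c3, c4, Equiv.Perm.sign_mul, Equiv.Perm.sign_swap hij.ne]
      simp [hi, hj]
      ring
    · simp [hj]
  · simp [hi]

end heat

end PermSum

/-! ### The sum over pairs of permutations equals the Hermite kernel. -/

section CovSum

variable {R 𝕜 : Type*} [CommRing R] [CommRing 𝕜] [Algebra 𝕜 R]

/-- The mixed moment of a diagonal entry; the propositions say whether it occurs in the term of the
first and of the second permutation. -/
def diagWeight (u v : R) (p q : Prop) [Decidable p] [Decidable q] : R :=
  if p then (if q then u * v + 1 else u) else (if q then v else 1)

/-- The expectation of the product of two opposite entries, restricted to those that occur. -/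
def pairMean (t : R) (p₁ p₂ : Prop) [Decidable p₁] [Decidable p₂] : R :=
  if p₁ then (if p₂ then t else 0) else (if p₂ then 0 else 1)

/-- The mixed moment of a pair of opposite off-diagonal entries; the propositions say which of the
two entries occur in the term of the first and of the second permutation. -/
def pairWeight (t t' : R) (p₁ p₂ q₁ q₂ : Prop) [Decidable p₁] [Decidable p₂] [Decidable q₁]
    [Decidable q₂] : R :=
  pairMean t p₁ p₂ * pairMean t' q₁ q₂ + (if (p₁ ↔ q₁) ∧ (p₂ ↔ q₂) ∧ (p₁ ∨ p₂) then 1 else 0)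

variable (ι : Type*) [Fintype ι] [LinearOrder ι]

/-- The signed sum over pairs of permutations of the products of the mixed moments. -/
def covSum (t t' u v : R) : R :=
  ∑ σ : Equiv.Perm ι, ∑ τ : Equiv.Perm ι,
    ((Equiv.Perm.sign σ : ℤ) : R) * ((Equiv.Perm.sign τ : ℤ) : R) *
    ((∏ i, diagWeight u v (σ i = i) (τ i = i)) * ∏ p ∈ upperPairs ι,
      pairWeight t t' (σ p.1 = p.2) (σ p.2 = p.1) (τ p.1 = p.2) (τ p.2 = p.1))

/-- Transfers the heat equation in `(t, u)` to the variables `(t', v)`. -/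
lemma covSum_symm (t t' u v : R) : covSum ι t t' u v = covSum ι t' t v u := by
  rw [covSum, Finset.sum_comm, covSum]
  refine Finset.sum_congr rfl fun σ _ => Finset.sum_congr rfl fun τ _ => ?_
  congr 1
  · ring
  congr 1
  · refine Finset.prod_congr rfl fun i _ => ?_
    simp only [diagWeight]
    split_ifs <;> ring
  · refine Finset.prod_congr rfl fun p _ => ?_
    simp only [pairWeight]
    congr 1
    · ring
    · exact if_congr (by tauto) rfl rfl

lemma map_covSum {S : Type*} [CommRing S] (f : R →+* S) (t t' u v : R) :
    f (covSum ι t t' u v) = covSum ι (f t) (f t') (f u) (f v) := by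
  simp only [covSum, map_sum, map_mul, map_prod, map_intCast, diagWeight, pairWeight, pairMean,
    apply_ite f, map_add, map_one, map_zero]

/-- Once `τ` is frozen, every block moment is affine in `u` or in `t`, with coefficients involving
only `t'` and `v`. This is the shape to which `permSum_heat` applies. -/
lemma covSum_eq_sum_permSum (t t' u v : R) :
    covSum ι t t' u v = ∑ τ : Equiv.Perm ι, ((Equiv.Perm.sign τ : ℤ) : R) *
      permSum t u (fun i => if τ i = i then v else 1) (fun i => if τ i = i then 1 else 0)
        (fun p => pairMean t' (τ p.1 = p.2) (τ p.2 = p.1))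
        (fun p => if τ p.1 = p.2 ∧ ¬ τ p.2 = p.1 then 1 else 0)
        (fun p => if ¬ τ p.1 = p.2 ∧ τ p.2 = p.1 then 1 else 0)
        (fun p => if τ p.1 = p.2 ∧ τ p.2 = p.1 then 1 else 0) := by
  rw [covSum, Finset.sum_comm]
  refine Finset.sum_congr rfl fun τ _ => ?_
  rw [permSum, Finset.mul_sum]
  refine Finset.sum_congr rfl fun σ _ => ?_
  have h1 : ∀ i, diagWeight u v (σ i = i) (τ i = i) =
      diagFactor u (fun i => if τ i = i then v else 1) (fun i => if τ i = i then 1 else 0) σ i :=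
    fun i => by simp only [diagWeight, diagFactor]; split_ifs <;> simp
  have h2 : ∀ p, pairWeight t t' (σ p.1 = p.2) (σ p.2 = p.1) (τ p.1 = p.2) (τ p.2 = p.1) =
      pairFactor t (fun p => pairMean t' (τ p.1 = p.2) (τ p.2 = p.1))
        (fun p => if τ p.1 = p.2 ∧ ¬ τ p.2 = p.1 then 1 else 0)
        (fun p => if ¬ τ p.1 = p.2 ∧ τ p.2 = p.1 then 1 else 0)
        (fun p => if τ p.1 = p.2 ∧ τ p.2 = p.1 then 1 else 0) σ p := fun p => by
    by_cases a : σ p.1 = p.2 <;> by_cases b : σ p.2 = p.1 <;> by_cases c : τ p.1 = p.2 <;>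
      by_cases d : τ p.2 = p.1 <;> simp [pairWeight, pairFactor, pairMean, a, b, c, d]
  simp only [h1, h2]
  ring

lemma covSum_heat (Dt Du : Derivation 𝕜 R R) {t t' u v : R} (htt : Dt t = 1) (htu : Dt u = 0)
    (hut : Du t = 0) (huu : Du u = 1) (htt' : Dt t' = 0) (htv : Dt v = 0) (hut' : Du t' = 0)
    (huv : Du v = 0) :
    2 * Dt (covSum ι t t' u v) = -Du (Du (covSum ι t t' u v)) := by
  have hite : ∀ (D : Derivation 𝕜 R R) (a b : R) (p : Prop) [Decidable p], D a = 0 → D b = 0 →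
      D (if p then a else b) = 0 := fun D a b p _ ha hb => by split_ifs <;> assumption
  have hmean : ∀ (D : Derivation 𝕜 R R) (p q : Prop) [Decidable p] [Decidable q], D t' = 0 →
      D (pairMean t' p q) = 0 := fun D p q _ _ h => by
    unfold pairMean
    exact hite _ _ _ _ (hite _ _ _ _ h (map_zero D)) (hite _ _ _ _ (map_zero D) (by simp))
  have hcast : ∀ (D : Derivation 𝕜 R R) (z : ℤ), D ((z : ℤ) : R) = 0 := fun D z => D.map_intCast z
  rw [covSum_eq_sum_permSum, map_sum, map_sum, map_sum, Finset.mul_sum, ← Finset.sum_neg_distrib]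
  refine Finset.sum_congr rfl fun τ _ => ?_
  simp only [Derivation.leibniz, hcast, smul_eq_mul, mul_zero, add_zero]
  rw [mul_left_comm, permSum_heat Dt Du htt htu hut huu]
  · ring
  all_goals intro i
  all_goals first
    | exact hmean _ _ _ (by assumption)
    | exact hite _ _ _ _ (by first | assumption | simp) (by simp)

/-- Expanding each factor `y + 1` chooses a set `s` of fixed points, and `(n - |s|)!` permutations
fix `s` pointwise. -/
lemma sum_perm_prod_fixed (y : R) :
    ∑ σ : Equiv.Perm ι, ∏ i, (if σ i = i then y + 1 else 1) =
      ∑ k ∈ Finset.range (Fintype.card ι + 1),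
        (((Fintype.card ι).choose k * (Fintype.card ι - k).factorial : ℕ) : R) * y ^ k := by
  classical
  have h1 : ∀ σ : Equiv.Perm ι, ∏ i, (if σ i = i then y + 1 else 1) =
      ∑ s ∈ (Finset.univ : Finset ι).powerset, if ∀ i ∈ s, σ i = i then y ^ s.card else 0 := by
    intro σ
    have : ∀ i, (if σ i = i then y + 1 else 1) = (if σ i = i then y else 0) + 1 := fun i => by
      split_ifs <;> simp
    simp only [this, Finset.prod_add, Finset.prod_const_one, mul_one]
    refine Finset.sum_congr rfl fun s _ => ?_
    rw [Finset.prod_ite_zero]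
    simp
  simp only [h1]
  rw [Finset.sum_comm]
  have h2 : ∀ s : Finset ι, ∑ σ : Equiv.Perm ι, (if ∀ i ∈ s, σ i = i then y ^ s.card else 0) =
      ((Fintype.card ι - s.card).factorial : R) * y ^ s.card := by
    intro s
    rw [← Finset.sum_filter, Finset.sum_const, nsmul_eq_mul]
    congr 2
    rw [← Fintype.card_subtype]
    have e := Equiv.Perm.subtypeEquivSubtypePerm (fun i : ι => i ∉ s)
    have : Fintype.card {σ : Equiv.Perm ι // ∀ i ∈ s, σ i = i} =
        Fintype.card (Equiv.Perm {i : ι // i ∉ s}) := by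
      refine Fintype.card_congr (Equiv.trans (Equiv.subtypeEquivRight fun σ => ?_) e.symm)
      simp
    rw [this, Fintype.card_perm, Fintype.card_subtype_compl]
    simp
  simp only [h2]
  rw [Finset.sum_powerset_apply_card
    (f := fun k => ((Fintype.card ι - k).factorial : R) * y ^ k)]
  simp only [Finset.card_univ, nsmul_eq_mul, Nat.cast_mul, mul_assoc]

/-- With zero variance parameters the mean of a pair vanishes as soon as one of its entries is used.
So `σ` and `τ` must use the same off-diagonal entries, which forces `σ = τ`. -/
lemma covSum_zero (u v : R) :
    covSum ι 0 0 u v = ∑ k ∈ Finset.range (Fintype.card ι + 1),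
        (((Fintype.card ι).choose k * (Fintype.card ι - k).factorial : ℕ) : R) * (u * v) ^ k := by
  rw [← sum_perm_prod_fixed, covSum]
  refine Finset.sum_congr rfl fun σ _ => ?_
  rw [Finset.sum_eq_single σ]
  · rw [← Int.cast_mul, Int.units_coe_mul_self, Int.cast_one, one_mul]
    rw [Finset.prod_eq_one (s := upperPairs ι), mul_one]
    · refine Finset.prod_congr rfl fun i _ => ?_
      simp only [diagWeight]; split_ifs <;> rfl
    · intro p _
      by_cases a : σ p.1 = p.2 <;> by_cases b : σ p.2 = p.1 <;> simp [pairWeight, pairMean, a, b]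
  · intro τ _ hτ
    -- A point moved by `σ` and sent elsewhere by `τ` exhibits an off-diagonal entry used by `σ`
    -- alone. If `σ` fixes the point of disagreement, then `τ` moves it and the roles are exchanged.
    have key : ∀ σ τ : Equiv.Perm ι, ∀ i, σ i ≠ i → σ i ≠ τ i → 
        ∃ p ∈ upperPairs ι, ¬ ((σ p.1 = p.2 ↔ τ p.1 = p.2) ∧ (σ p.2 = p.1 ↔ τ p.2 = p.1)) := by
      intro σ τ i hi hne
      rcases lt_or_gt_of_ne hi with h | h
      · exact ⟨(σ i, i), mem_upperPairs.2 h, fun hh => hne (hh.2.1 rfl).symm⟩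
      · exact ⟨(i, σ i), mem_upperPairs.2 h, fun hh => hne (hh.1.1 rfl).symm⟩
    have : ∃ p ∈ upperPairs ι,
        ¬ ((σ p.1 = p.2 ↔ τ p.1 = p.2) ∧ (σ p.2 = p.1 ↔ τ p.2 = p.1)) := by
      obtain ⟨i, hi⟩ : ∃ i, σ i ≠ τ i := by
        by_contra! h
        exact hτ (Equiv.ext fun i => (h i).symm)
      by_cases h : σ i = i
      · obtain ⟨p, hp, h'⟩ := key τ σ i (fun h' => hi (h.trans h'.symm)) hi.symm
        exact ⟨p, hp, fun hh => h' ⟨hh.1.symm, hh.2.symm⟩⟩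
      · exact key σ τ i h hi
    obtain ⟨p, hp, h⟩ := this
    rw [Finset.prod_eq_zero (i := p) hp, mul_zero, mul_zero]
    by_cases a : σ p.1 = p.2 <;> by_cases b : σ p.2 = p.1 <;> by_cases c : τ p.1 = p.2 <;>
      by_cases d : τ p.2 = p.1 <;> simp_all [pairWeight, pairMean]
  · simp

/-- A polynomial that solves both heat equations and vanishes at time zero is zero. -/
lemma eq_zero_of_heat (P : MvPolynomial (Fin 4) ℂ)
    (h0 : 2 * MvPolynomial.pderiv 0 P = -MvPolynomial.pderiv 2 (MvPolynomial.pderiv 2 P))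
    (h1 : 2 * MvPolynomial.pderiv 1 P = -MvPolynomial.pderiv 3 (MvPolynomial.pderiv 3 P))
    (hz : MvPolynomial.aeval ![0, 0, MvPolynomial.X 2, MvPolynomial.X 3] P
      = (0 : MvPolynomial (Fin 4) ℂ)) : P = 0 := by
  have hcoeff : ∀ (Q : MvPolynomial (Fin 4) ℂ) (m : Fin 4 →₀ ℕ), m 0 = 0 → m 1 = 0 →
      MvPolynomial.coeff m (MvPolynomial.aeval ![0, 0, MvPolynomial.X 2, MvPolynomial.X 3] Q
        : MvPolynomial (Fin 4) ℂ) = MvPolynomial.coeff m Q := by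
    intro Q m hm0 hm1
    induction Q using MvPolynomial.induction_on' with
    | add p q hp hq => rw [map_add, MvPolynomial.coeff_add, MvPolynomial.coeff_add, hp, hq]
    | monomial s a =>
      rw [MvPolynomial.aeval_monomial]
      by_cases hs : s 0 = 0 ∧ s 1 = 0
      · rw [MvPolynomial.monomial_eq, Finsupp.prod_fintype _ _ (by simp),
          Finsupp.prod_fintype _ _ (by simp)]
        simp [Fin.prod_univ_four, hs.1, hs.2, MvPolynomial.algebraMap_eq]
      · have hne : s ≠ m := fun h => hs ⟨h ▸ hm0, h ▸ hm1⟩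
        rw [MvPolynomial.coeff_monomial, if_neg hne, Finsupp.prod_fintype _ _ (by simp)]
        rw [not_and_or] at hs
        rcases hs with hs | hs <;> simp [Fin.prod_univ_four, hs]
  have main : ∀ (k : ℕ) (m : Fin 4 →₀ ℕ), m 0 + m 1 = k → MvPolynomial.coeff m P = 0 := by
    intro k
    induction k with
    | zero =>
      intro m hm
      rw [← hcoeff P m (by omega) (by omega), hz, MvPolynomial.coeff_zero]
    | succ k ih =>
      intro m hm
      -- Comparing coefficients in the heat equation, a nonzero multiple of the coefficient at `m`
      -- is a multiple of the one at `m` with one time exponent lowered by 1 and a space exponent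
      -- raised by 2. The latter has smaller time degree and is zero by induction.
      have step : ∀ i j : Fin 4, (i = 0 ∨ i = 1) → j ≠ 0 → j ≠ 1 →
          2 * MvPolynomial.pderiv i P = -MvPolynomial.pderiv j (MvPolynomial.pderiv j P) →
          m i ≠ 0 → MvPolynomial.coeff m P = 0 := by
        intro i j hi hj0 hj1 h hmi
        set m' : Fin 4 →₀ ℕ := m - Finsupp.single i 1 with hm'
        have hmm : m = m' + Finsupp.single i 1 := by
          rw [hm', tsub_add_cancel_of_le]
          simpa using Nat.one_le_iff_ne_zero.2 hmi
        have hc := congrArg (MvPolynomial.coeff m') h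
        have e2 : (2 : MvPolynomial (Fin 4) ℂ) = MvPolynomial.C 2 :=
          (map_ofNat MvPolynomial.C 2).symm
        rw [e2, MvPolynomial.coeff_C_mul, MvPolynomial.coeff_neg, MvPolynomial.coeff_pderiv,
          MvPolynomial.coeff_pderiv, MvPolynomial.coeff_pderiv, ← hmm] at hc
        have hz : MvPolynomial.coeff (m' + Finsupp.single j 1 + Finsupp.single j 1) P = 0 := by
          apply ih
          rcases hi with rfl | rfl
          · have a := congrArg (fun f : Fin 4 →₀ ℕ => f 0) hmm
            have b := congrArg (fun f : Fin 4 →₀ ℕ => f 1) hmm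
            simp at a b
            simp [hj0.symm, hj1.symm]
            omega
          · have a := congrArg (fun f : Fin 4 →₀ ℕ => f 0) hmm
            have b := congrArg (fun f : Fin 4 →₀ ℕ => f 1) hmm
            simp at a b
            simp [hj0.symm, hj1.symm]
            omega
        rw [hz] at hc
        simp only [zero_mul, neg_zero, mul_eq_zero, OfNat.ofNat_ne_zero, false_or] at hc
        rcases hc with hc | hc
        · exact hc
        · exact absurd hc (Nat.cast_add_one_ne_zero _)
      by_cases h : m 0 = 0
      · exact step 1 3 (Or.inr rfl) (by decide) (by decide) h1 (by omega)
      · exact step 0 2 (Or.inl rfl) (by decide) (by decide) h0 h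
  ext m
  simpa using main _ m rfl

/-- The truncated Hermite kernel of size `n`. -/
def hermiteSum (n : ℕ) (t t' u v : R) : R :=
  ∑ k ∈ Finset.range (n + 1), ((n.choose k * (n - k).factorial : ℕ) : R) *
    (hermiteVar t u k * hermiteVar t' v k)

lemma hermiteSum_symm (n : ℕ) (t t' u v : R) :
    hermiteSum n t t' u v = hermiteSum n t' t v u := by
  simp only [hermiteSum, mul_comm (hermiteVar t u _)]

lemma map_hermiteSum {S : Type*} [CommRing S] (f : R →+* S) (n : ℕ) (t t' u v : R) :
    f (hermiteSum n t t' u v) = hermiteSum n (f t) (f t') (f u) (f v) := by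
  simp only [hermiteSum, map_sum, map_mul, map_natCast, map_hermiteVar]

lemma derivation_hermiteVar_eq_zero (D : Derivation 𝕜 R R) {t u : R} (ht : D t = 0) (hu : D u = 0)
    (k : ℕ) : D (hermiteVar t u k) = 0 := by
  induction k using Nat.strong_induction_on with
  | _ k ih =>
    match k with
    | 0 => simp [hermiteVar]
    | 1 => simpa [hermiteVar]
    | k + 2 =>
      have hk : D ((k : R)) = 0 := D.map_natCast k
      simp [hermiteVar, ih k (by omega), ih (k + 1) (by omega), ht, hu, hk]

lemma hermiteVar_heat (Dt Du : Derivation 𝕜 R R) {t u : R} (htt : Dt t = 1) (htu : Dt u = 0)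
    (hut : Du t = 0) (huu : Du u = 1) (k : ℕ) :
    2 * Dt (hermiteVar t u k) = -Du (Du (hermiteVar t u k)) := by
  match k with
  | 0 => simp [hermiteVar]
  | 1 => simp [hermiteVar, htu, huu]
  | k + 2 =>
    have hk : Du ((k : R)) = 0 := Du.map_natCast k
    rw [derivation_hermiteVar_left Dt htt htu, derivation_hermiteVar_right Du hut huu (k + 1)]
    simp only [Derivation.leibniz, derivation_hermiteVar_right Du hut huu k, smul_eq_mul,
      Nat.cast_add, Nat.cast_one, map_add, hk, Derivation.map_one_eq_zero]
    ring

lemma hermiteSum_heat (n : ℕ) (Dt Du : Derivation 𝕜 R R) {t t' u v : R} (htt : Dt t = 1)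
    (htu : Dt u = 0) (hut : Du t = 0) (huu : Du u = 1) (htt' : Dt t' = 0) (htv : Dt v = 0)
    (hut' : Du t' = 0) (huv : Du v = 0) :
    2 * Dt (hermiteSum n t t' u v) = -Du (Du (hermiteSum n t t' u v)) := by
  simp only [hermiteSum, map_sum, Finset.mul_sum, ← Finset.sum_neg_distrib]
  refine Finset.sum_congr rfl fun k _ => ?_
  have a := hermiteVar_heat Dt Du htt htu hut huu k
  have b := derivation_hermiteVar_eq_zero Dt htt' htv k
  have b' := derivation_hermiteVar_eq_zero Du hut' huv k
  have d : ∀ (D : Derivation 𝕜 R R) (m : ℕ), D ((m : R)) = 0 := fun D m => D.map_natCast _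
  simp only [Derivation.leibniz, b, b', d, smul_eq_mul, mul_zero, zero_add, add_zero]
  linear_combination ((n.choose k * (n - k).factorial : ℕ) : R) * hermiteVar t' v k * a

/-- The Hermite kernel evaluation of the signed sum over pairs of permutations. -/
theorem covSum_eq_hermiteSum (t t' u v : ℂ) :
    covSum ι t t' u v = hermiteSum (Fintype.card ι) t t' u v := by
  have h1 : ∀ i : Fin 4, MvPolynomial.pderiv i (MvPolynomial.X i : MvPolynomial (Fin 4) ℂ) = 1 :=
    fun i => MvPolynomial.pderiv_X_self i
  have h0 : ∀ i j : Fin 4, j ≠ i →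
      MvPolynomial.pderiv i (MvPolynomial.X j : MvPolynomial (Fin 4) ℂ) = 0 :=
    fun i j h => MvPolynomial.pderiv_X_of_ne h
  -- The identity is proved for four indeterminates, where the partial derivatives are derivations
  -- that vanish on the other variables, and is specialised at the end.
  have key : covSum ι (MvPolynomial.X 0 : MvPolynomial (Fin 4) ℂ) (MvPolynomial.X 1)
      (MvPolynomial.X 2) (MvPolynomial.X 3) - hermiteSum (Fintype.card ι) (MvPolynomial.X 0)
      (MvPolynomial.X 1) (MvPolynomial.X 2) (MvPolynomial.X 3) = 0 := by
    apply eq_zero_of_heat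
    · rw [map_sub, map_sub, map_sub, mul_sub,
        covSum_heat ι (MvPolynomial.pderiv 0) (MvPolynomial.pderiv 2) (h1 0) (h0 _ _ (by decide))
          (h0 _ _ (by decide)) (h1 2) (h0 _ _ (by decide)) (h0 _ _ (by decide))
          (h0 _ _ (by decide)) (h0 _ _ (by decide)),
        hermiteSum_heat _ (MvPolynomial.pderiv 0) (MvPolynomial.pderiv 2) (h1 0)
          (h0 _ _ (by decide)) (h0 _ _ (by decide)) (h1 2) (h0 _ _ (by decide))
          (h0 _ _ (by decide)) (h0 _ _ (by decide)) (h0 _ _ (by decide))]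
      abel
    · rw [covSum_symm, hermiteSum_symm, map_sub, map_sub, map_sub, mul_sub,
        covSum_heat ι (MvPolynomial.pderiv 1) (MvPolynomial.pderiv 3) (h1 1) (h0 _ _ (by decide))
          (h0 _ _ (by decide)) (h1 3) (h0 _ _ (by decide)) (h0 _ _ (by decide))
          (h0 _ _ (by decide)) (h0 _ _ (by decide)),
        hermiteSum_heat _ (MvPolynomial.pderiv 1) (MvPolynomial.pderiv 3) (h1 1)
          (h0 _ _ (by decide)) (h0 _ _ (by decide)) (h1 3) (h0 _ _ (by decide))
          (h0 _ _ (by decide)) (h0 _ _ (by decide)) (h0 _ _ (by decide))]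
      abel
    · rw [map_sub, sub_eq_zero, ← RingHom.coe_coe, map_covSum, map_hermiteSum]
      simp only [RingHom.coe_coe, MvPolynomial.aeval_X, Matrix.cons_val]
      rw [covSum_zero]
      simp only [hermiteSum, hermiteVar_zero_left, mul_pow]
  have hfin := congrArg (MvPolynomial.aeval ![t, t', u, v]) (sub_eq_zero.1 key)
  rw [← RingHom.coe_coe, map_covSum, map_hermiteSum] at hfin
  simpa only [RingHom.coe_coe, MvPolynomial.aeval_X, Matrix.cons_val] using hfin

end CovSum

/-! ### Finite moments, and low mixed moments of real and complex Gaussians. -/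

section Moments

open scoped NNReal ENNReal

/-- All moments of `f` are finite. -/
def AllMoments {Ω : Type*} [MeasurableSpace Ω] (f : Ω → ℂ) (μ : Measure Ω) : Prop :=
  ∀ p : ℝ≥0, MemLp f p μ

namespace AllMoments

variable {Ω : Type*} [MeasurableSpace Ω] {μ : Measure Ω} {f g : Ω → ℂ}

lemma integrable (hf : AllMoments f μ) : Integrable f μ :=
  memLp_one_iff_integrable.1 (by simpa using hf 1)

lemma const [IsFiniteMeasure μ] (c : ℂ) : AllMoments (fun _ => c) μ := fun _ => memLp_const c

lemma add (hf : AllMoments f μ) (hg : AllMoments g μ) : AllMoments (fun x => f x + g x) μ :=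
  fun p => (hf p).add (hg p)

lemma sub (hf : AllMoments f μ) (hg : AllMoments g μ) : AllMoments (fun x => f x - g x) μ :=
  fun p => (hf p).sub (hg p)

/-- Hölder's inequality with both exponents equal to `2p`. -/
lemma mul (hf : AllMoments f μ) (hg : AllMoments g μ) : AllMoments (fun x => f x * g x) μ := by
  intro p
  have : ENNReal.HolderTriple ((2 * p : ℝ≥0) : ℝ≥0∞) ((2 * p : ℝ≥0) : ℝ≥0∞) (p : ℝ≥0∞) := by
    constructor
    rcases eq_or_ne p 0 with rfl | hp
    · simp
    · rw [← ENNReal.coe_inv (by positivity), ← ENNReal.coe_inv hp, ← ENNReal.coe_add,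
        ENNReal.coe_inj]
      field_simp
      norm_num
  exact (hg (2 * p)).mul (hf (2 * p))

lemma const_mul [IsFiniteMeasure μ] (c : ℂ) (hf : AllMoments f μ) :
    AllMoments (fun x => c * f x) μ := (const c).mul hf

lemma conj (hf : AllMoments f μ) : AllMoments (fun x => (starRingEnd ℂ) (f x)) μ := fun p =>
  (hf p).of_le (Complex.continuous_conj.comp_aestronglyMeasurable (hf p).1) (by simp)

lemma pow [IsFiniteMeasure μ] (hf : AllMoments f μ) (k : ℕ) : AllMoments (fun x => f x ^ k) μ := by
  induction k with
  | zero => simpa using const 1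
  | succ k ih => simpa only [pow_succ] using ih.mul hf

lemma finset_sum [IsFiniteMeasure μ] {α : Type*} (s : Finset α) {F : α → Ω → ℂ}
    (h : ∀ a ∈ s, AllMoments (F a) μ) : AllMoments (fun x => ∑ a ∈ s, F a x) μ := by
  classical
  induction s using Finset.induction_on with
  | empty => simpa using const 0
  | insert a s ha ih =>
    simp only [Finset.sum_insert ha]
    exact (h a (by simp)).add (ih fun b hb => h b (by simp [hb]))

lemma finset_prod [IsFiniteMeasure μ] {α : Type*} (s : Finset α) {F : α → Ω → ℂ}
    (h : ∀ a ∈ s, AllMoments (F a) μ) : AllMoments (fun x => ∏ a ∈ s, F a x) μ := by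
  classical
  induction s using Finset.induction_on with
  | empty => simpa using const 1
  | insert a s ha ih =>
    simp only [Finset.prod_insert ha]
    exact (h a (by simp)).mul (ih fun b hb => h b (by simp [hb]))

lemma comp_measurePreserving {Ω' : Type*} [MeasurableSpace Ω'] {ν : Measure Ω'} {φ : Ω' → Ω}
    (hf : AllMoments f μ) (hφ : MeasurePreserving φ ν μ) : AllMoments (fun x => f (φ x)) ν :=
  fun p => (hf p).comp_measurePreserving hφ

end AllMoments

lemma allMoments_gaussianReal : AllMoments (fun x : ℝ => (x : ℂ)) (gaussianReal 0 1) :=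
  fun p => (memLp_id_gaussianReal p).ofReal

lemma integral_pow_gaussianReal_le_four :
    (∫ x : ℝ, x ∂gaussianReal 0 1 = 0) ∧ (∫ x : ℝ, x ^ 2 ∂gaussianReal 0 1 = 1) ∧
    (∫ x : ℝ, x ^ 3 ∂gaussianReal 0 1 = 0) ∧ (∫ x : ℝ, x ^ 4 ∂gaussianReal 0 1 = 3) := by
  have hm : mgf id (gaussianReal 0 1) = fun t => Real.exp (t ^ 2 / 2) := by
    rw [mgf_id_gaussianReal]; ext t; simp
  have hInt : (0 : ℝ) ∈ interior (integrableExpSet id (gaussianReal 0 1)) := by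
    simp [integrableExpSet_id_gaussianReal]
  have hk : ∀ k, ∫ x : ℝ, x ^ k ∂gaussianReal 0 1 =
      iteratedDeriv k (fun t : ℝ => Real.exp (t ^ 2 / 2)) 0 := fun k => by
    rw [← hm, iteratedDeriv_mgf_zero hInt]; simp
  have step : ∀ (p p' : ℝ → ℝ), (∀ t, HasDerivAt p (p' t) t) →
      deriv (fun t => p t * Real.exp (t ^ 2 / 2)) =
        fun t => (p' t + p t * t) * Real.exp (t ^ 2 / 2) := by
    intro p p' hp
    ext t
    have h1 : HasDerivAt (fun t : ℝ => t ^ 2 / 2) t t := by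
      convert! (hasDerivAt_pow 2 t).div_const 2 using 1; simp
    have h2 : HasDerivAt (fun t => p t * Real.exp (t ^ 2 / 2)) _ t := (hp t).mul h1.exp
    rw [h2.deriv]; ring
  have d0 : (fun t : ℝ => Real.exp (t ^ 2 / 2)) = fun t => 1 * Real.exp (t ^ 2 / 2) := by simp
  have d1 : iteratedDeriv 1 (fun t : ℝ => Real.exp (t ^ 2 / 2)) =
      fun t => t * Real.exp (t ^ 2 / 2) := by
    rw [iteratedDeriv_one, d0, step _ (fun _ => 0) fun t => hasDerivAt_const t 1]; simp
  have d2 : iteratedDeriv 2 (fun t : ℝ => Real.exp (t ^ 2 / 2)) =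
      fun t => (1 + t * t) * Real.exp (t ^ 2 / 2) := by
    rw [iteratedDeriv_succ, d1, step (fun t => t) (fun _ => 1) fun t => hasDerivAt_id t]
  have d3 : iteratedDeriv 3 (fun t : ℝ => Real.exp (t ^ 2 / 2)) =
      fun t => ((1 * t + t * 1) + (1 + t * t) * t) * Real.exp (t ^ 2 / 2) := by
    rw [iteratedDeriv_succ, d2, step (fun t => 1 + t * t) (fun t => 1 * t + t * 1) fun t =>
      ((hasDerivAt_id t).mul (hasDerivAt_id t)).const_add 1]
  have d4 : iteratedDeriv 4 (fun t : ℝ => Real.exp (t ^ 2 / 2)) 0 = 3 := by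
    have d3' : iteratedDeriv 3 (fun t : ℝ => Real.exp (t ^ 2 / 2)) =
        fun t => (t * 3 + t ^ 3) * Real.exp (t ^ 2 / 2) := by
      rw [d3]; ext t; ring
    rw [iteratedDeriv_succ, d3', step (fun t => t * 3 + t ^ 3) (fun t => 1 * 3 + (3 : ℕ) * t ^ (3 - 1)) fun t =>
      ((hasDerivAt_id t).mul_const 3).add (hasDerivAt_pow 3 t)]
    simp
  refine ⟨by simp, ?_, ?_, ?_⟩
  · rw [hk, d2]; simp
  · rw [hk, d3]; simp
  · rw [hk, d4]

/-- Degree 4 suffices: each permutation uses an entry at most once, so a block contributes at most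
four Gaussian factors. Taking the coefficients as explicit data leaves only a polynomial identity to
check in each use. -/
lemma integral_quartic_gaussianReal {f : ℝ → ℂ} (c₀ c₁ c₂ c₃ c₄ : ℂ)
    (hf : ∀ x : ℝ, f x = c₀ + c₁ * x + c₂ * x ^ 2 + c₃ * x ^ 3 + c₄ * x ^ 4) :
    ∫ x, f x ∂gaussianReal 0 1 = c₀ + c₂ + 3 * c₄ := by
  obtain ⟨h1, h2, h3, h4⟩ := integral_pow_gaussianReal_le_four
  have hi : ∀ k, Integrable (fun x : ℝ => (x : ℂ) ^ k) (gaussianReal 0 1) := fun k =>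
    (allMoments_gaussianReal.pow k).integrable
  have e1 : ∫ x : ℝ, (x : ℂ) ∂gaussianReal 0 1 = 0 := by
    rw [integral_complex_ofReal, h1]; simp
  have e2 : ∫ x : ℝ, (x : ℂ) ^ 2 ∂gaussianReal 0 1 = 1 := by
    simp only [← Complex.ofReal_pow]; rw [integral_complex_ofReal, h2]; simp
  have e3 : ∫ x : ℝ, (x : ℂ) ^ 3 ∂gaussianReal 0 1 = 0 := by
    simp only [← Complex.ofReal_pow]; rw [integral_complex_ofReal, h3]; simp
  have e4 : ∫ x : ℝ, (x : ℂ) ^ 4 ∂gaussianReal 0 1 = 3 := by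
    simp only [← Complex.ofReal_pow]; rw [integral_complex_ofReal, h4]; simp
  have hsum : ∀ x : ℝ, f x = ∑ k : Fin 5, ![c₀, c₁, c₂, c₃, c₄] k * (x : ℂ) ^ (k : ℕ) := fun x => by
    simp [hf, Fin.sum_univ_five]
  simp only [hsum]
  rw [integral_finsetSum _ fun (k : Fin 5) _ => (hi (k : ℕ)).const_mul _]
  simp only [integral_const_mul]
  simp [Fin.sum_univ_five, e1, e2, e3, e4]
  ring

/-- The standard complex Gaussian variable built from two standard real ones. -/
def complexGaussian (x : ℝ × ℝ) : ℂ := ((x.1 : ℂ) + Complex.I * (x.2 : ℂ)) / (√2 : ℝ)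

lemma allMoments_complexGaussian :
    AllMoments complexGaussian ((gaussianReal 0 1).prod (gaussianReal 0 1)) := by
  have h1 : AllMoments (fun x : ℝ × ℝ => (x.1 : ℂ)) ((gaussianReal 0 1).prod (gaussianReal 0 1)) :=
    allMoments_gaussianReal.comp_measurePreserving measurePreserving_fst
  have h2 : AllMoments (fun x : ℝ × ℝ => (x.2 : ℂ)) ((gaussianReal 0 1).prod (gaussianReal 0 1)) :=
    allMoments_gaussianReal.comp_measurePreserving measurePreserving_snd
  have h3 := (h1.add (h2.const_mul Complex.I)).const_mul ((√2 : ℝ) : ℂ)⁻¹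
  convert! h3 using 2 with x
  rw [complexGaussian, div_eq_inv_mul]

/-- Computed by integrating out the imaginary coordinate and then the real one. Exponents up to 2
cover the product of two functions of degree at most one in each of `X` and `conj X`. -/
lemma integral_complexGaussian (p q : Fin 3) :
    ∫ x, complexGaussian x ^ (p : ℕ) * (starRingEnd ℂ) (complexGaussian x) ^ (q : ℕ)
      ∂(gaussianReal 0 1).prod (gaussianReal 0 1) = if p = q then ((p : ℕ).factorial : ℂ) else 0 := by
  have hInt : Integrable (fun x => complexGaussian x ^ (p : ℕ) *
      (starRingEnd ℂ) (complexGaussian x) ^ (q : ℕ)) ((gaussianReal 0 1).prod (gaussianReal 0 1)) :=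
    ((allMoments_complexGaussian.pow _).mul (allMoments_complexGaussian.conj.pow _)).integrable
  rw [integral_prod _ hInt]
  have hs : (((√2 : ℝ) : ℂ)) ^ 2 = 2 := by
    rw [← Complex.ofReal_pow, Real.sq_sqrt (by norm_num)]; norm_num
  have hs0 : (((√2 : ℝ) : ℂ)) ≠ 0 := fun h => by simp [h] at hs
  set s : ℂ := ((√2 : ℝ) : ℂ) with hsdef
  have hI : Complex.I ^ 2 = -1 := Complex.I_sq
  have hc : ∀ x y : ℝ, complexGaussian (x, y) = s⁻¹ * (x + Complex.I * y) := fun x y => by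
    rw [complexGaussian, div_eq_inv_mul]
  have hcc : ∀ x y : ℝ, (starRingEnd ℂ) (s⁻¹ * (x + Complex.I * y)) =
      s⁻¹ * (x - Complex.I * y) := fun x y => by
    rw [map_mul, map_inv₀, hsdef, Complex.conj_ofReal]; simp [sub_eq_add_neg]
  have hr : (s⁻¹) ^ 2 = 1 / 2 := by rw [inv_pow, hs]; norm_num
  simp only [hc, hcc]
  set r := s⁻¹
  clear_value r
  fin_cases p <;> fin_cases q <;>
    simp only [Fin.zero_eta, Fin.mk_one, Fin.reduceFinMk, Fin.isValue, pow_zero, pow_one,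
      mul_one, one_mul, reduceIte, Nat.factorial]
  · simp
  · rw [integral_quartic_gaussianReal 0 r 0 0 0]
    · simp
    intro x
    rw [integral_quartic_gaussianReal (r * x) (-r * Complex.I) 0 0 0 (fun y => by ring)]
    ring
  · rw [integral_quartic_gaussianReal (-r ^ 2) 0 (r ^ 2) 0 0]
    · simp
    intro x
    rw [integral_quartic_gaussianReal (r ^ 2 * x ^ 2) (-2 * r ^ 2 * x * Complex.I) (-r ^ 2) 0 0
      (fun y => by linear_combination (r ^ 2 * y ^ 2) * hI)]
    ring
  · rw [integral_quartic_gaussianReal 0 r 0 0 0]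
    · simp
    intro x
    rw [integral_quartic_gaussianReal (r * x) (r * Complex.I) 0 0 0 (fun y => by ring)]
    ring
  · rw [integral_quartic_gaussianReal (1 / 2) 0 (1 / 2) 0 0]
    · norm_num
    intro x
    rw [integral_quartic_gaussianReal (1 / 2 * x ^ 2) 0 (1 / 2) 0 0
      (fun y => by linear_combination (x ^ 2 + y ^ 2) * hr - r ^ 2 * y ^ 2 * hI)]
    ring
  · rw [integral_quartic_gaussianReal 0 (r / 2) 0 (r / 2) 0]
    · simp
    intro x
    rw [integral_quartic_gaussianReal (r / 2 * x ^ 3) (-r / 2 * Complex.I * x ^ 2) (r / 2 * x)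
      (-r / 2 * Complex.I) 0 (fun y => by
        linear_combination (x ^ 2 + y ^ 2) * (r * (x - Complex.I * y)) * hr -
          r ^ 2 * y ^ 2 * (r * (x - Complex.I * y)) * hI)]
    ring
  · rw [integral_quartic_gaussianReal (-r ^ 2) 0 (r ^ 2) 0 0]
    · simp
    intro x
    rw [integral_quartic_gaussianReal (r ^ 2 * x ^ 2) (2 * r ^ 2 * x * Complex.I) (-r ^ 2) 0 0
      (fun y => by linear_combination (r ^ 2 * y ^ 2) * hI)]
    ring
  · rw [integral_quartic_gaussianReal 0 (r / 2) 0 (r / 2) 0]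
    · simp
    intro x
    rw [integral_quartic_gaussianReal (r / 2 * x ^ 3) (r / 2 * Complex.I * x ^ 2) (r / 2 * x)
      (r / 2 * Complex.I) 0 (fun y => by
        linear_combination (x ^ 2 + y ^ 2) * (r * (x + Complex.I * y)) * hr -
          r ^ 2 * y ^ 2 * (r * (x + Complex.I * y)) * hI)]
    ring
  · rw [integral_quartic_gaussianReal (3 / 4) 0 (1 / 2) 0 (1 / 4)]
    · norm_num
    intro x
    have key : ∀ y : ℝ, (r * (x + Complex.I * y)) * (r * (x - Complex.I * y)) =
        1 / 2 * ((x : ℂ) ^ 2 + y ^ 2) := fun y => by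
      linear_combination ((x : ℂ) ^ 2 + y ^ 2) * hr - r ^ 2 * y ^ 2 * hI
    rw [integral_quartic_gaussianReal (1 / 4 * x ^ 4) 0 (1 / 2 * x ^ 2) 0 (1 / 4)
      (fun y => by rw [← mul_pow, key]; ring)]
    ring

/-- The mixed second moment of two functions that are affine in `X`, in `conj X` and in their
product, for a standard complex Gaussian `X`. -/
lemma integral_biaffine_complexGaussian (p₀ p₁ p₂ p₃ q₀ q₁ q₂ q₃ : ℂ) :
    ∫ x, (p₀ + p₁ * complexGaussian x + p₂ * (starRingEnd ℂ) (complexGaussian x) +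
        p₃ * (complexGaussian x * (starRingEnd ℂ) (complexGaussian x))) *
      (q₀ + q₁ * (starRingEnd ℂ) (complexGaussian x) + q₂ * complexGaussian x +
        q₃ * (complexGaussian x * (starRingEnd ℂ) (complexGaussian x)))
      ∂(gaussianReal 0 1).prod (gaussianReal 0 1) =
    (p₀ + p₃) * (q₀ + q₃) + p₁ * q₁ + p₂ * q₂ + p₃ * q₃ := by
  let C : Fin 3 → Fin 3 → ℂ := ![![p₀ * q₀, p₀ * q₁ + p₂ * q₀, p₂ * q₁],
    ![p₀ * q₂ + p₁ * q₀, p₀ * q₃ + p₁ * q₁ + p₂ * q₂ + p₃ * q₀, p₂ * q₃ + p₃ * q₁],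
    ![p₁ * q₂, p₁ * q₃ + p₃ * q₂, p₃ * q₃]]
  have h : ∀ x, (p₀ + p₁ * complexGaussian x + p₂ * (starRingEnd ℂ) (complexGaussian x) +
        p₃ * (complexGaussian x * (starRingEnd ℂ) (complexGaussian x))) *
      (q₀ + q₁ * (starRingEnd ℂ) (complexGaussian x) + q₂ * complexGaussian x +
        q₃ * (complexGaussian x * (starRingEnd ℂ) (complexGaussian x))) =
      ∑ a : Fin 3, ∑ b : Fin 3, C a b * (complexGaussian x ^ (a : ℕ) *
        (starRingEnd ℂ) (complexGaussian x) ^ (b : ℕ)) := fun x => by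
    simp [Fin.sum_univ_three, C]
    ring
  have hi : ∀ a b : Fin 3, Integrable (fun x => C a b * (complexGaussian x ^ (a : ℕ) *
        (starRingEnd ℂ) (complexGaussian x) ^ (b : ℕ)))
        ((gaussianReal 0 1).prod (gaussianReal 0 1)) := fun a b =>
    (((allMoments_complexGaussian.pow _).mul
      (allMoments_complexGaussian.conj.pow _)).const_mul _).integrable
  simp only [h]
  rw [integral_finsetSum _ fun a _ => integrable_finsetSum _ fun b _ => hi a b]
  simp only [integral_finsetSum _ fun b _ => hi _ b, integral_const_mul, integral_complexGaussian]
  simp [Fin.sum_univ_three, C]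
  ring

end Moments

/-! ### Independence of the blocks of opposite positions. -/

section Independence

/-- Grouping independent variables by the fibers of a map gives independent blocks. -/
lemma iIndepFun_fibers {Ω ι κ 𝓧 : Type*} [MeasurableSpace Ω] [MeasurableSpace 𝓧] {P : Measure Ω}
    [IsProbabilityMeasure P] {X : ι → Ω → 𝓧} (mX : ∀ i, Measurable (X i)) (h : iIndepFun X P)
    (f : ι → κ) : iIndepFun (fun k ω (x : {i // f i = k}) => X x ω) P := by
  have hm : ∀ i, IsProbabilityMeasure (P.map (X i)) := fun i =>
    Measure.isProbabilityMeasure_map (mX i).aemeasurable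
  rw [iIndepFun_iff_map_fun_eq_infinitePi_map (by fun_prop)]
  have hs : iIndepFun (fun (s : (k : κ) × {i // f i = k}) ω => X s.2 ω) P :=
    h.precomp (g := fun s : (k : κ) × {i // f i = k} => (s.2 : ι))
      (Equiv.sigmaFiberEquiv f).injective
  have h1 := (iIndepFun_iff_map_fun_eq_infinitePi_map (fun s => mX _)).1 hs
  have h2 := Measure.infinitePi_map_piCurry
    (fun (k : κ) (x : {i // f i = k}) => P.map (X (x : ι)))
  have h3 : ∀ k, P.map (fun ω (x : {i // f i = k}) => X x ω) =
      Measure.infinitePi fun x : {i // f i = k} => P.map (X (x : ι)) := fun k =>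
    (iIndepFun_iff_map_fun_eq_infinitePi_map (fun s => mX _)).1
      (h.precomp Subtype.val_injective)
  simp only [h3]
  rw [← h2, ← h1, Measure.map_map (by fun_prop) (by fun_prop)]
  rfl

/-- The law of an `n × n` array of independent standard Gaussians. -/
abbrev gaussianArray (n : ℕ) : Measure (Fin n → Fin n → ℝ) :=
  Measure.pi fun _ : Fin n => Measure.pi fun _ : Fin n => gaussianReal 0 1

lemma iIndepFun_pi_pi {n : ℕ} {𝓧 : Type*} [MeasurableSpace 𝓧] (ρ : Measure 𝓧)
    [IsProbabilityMeasure ρ] :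
    iIndepFun (fun (p : Fin n × Fin n) (ω : Fin n → Fin n → 𝓧) => ω p.1 p.2)
      (Measure.pi fun _ : Fin n => Measure.pi fun _ : Fin n => ρ) := by
  have h := iIndepFun_uncurry_infinitePi' (ι := Fin n) (κ := Fin n) (X := fun _ _ x => x)
    (fun _ _ => ρ) (fun _ _ => measurable_id)
  simpa only [Measure.infinitePi_eq_pi] using h

lemma measurePreserving_unzip_array (n : ℕ) :
    MeasurePreserving (fun (ω : Fin n → Fin n → ℝ × ℝ) =>
      ((fun i j => (ω i j).1, fun i j => (ω i j).2) : (Fin n → Fin n → ℝ) × (Fin n → Fin n → ℝ)))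
      (Measure.pi fun _ : Fin n => Measure.pi fun _ : Fin n =>
        (gaussianReal 0 1).prod (gaussianReal 0 1))
      ((gaussianArray n).prod (gaussianArray n)) := by
  have h1 := measurePreserving_pi (ι := Fin n)
    (fun _ => Measure.pi fun _ : Fin n => (gaussianReal 0 1).prod (gaussianReal 0 1))
    (fun _ => (Measure.pi fun _ : Fin n => gaussianReal 0 1).prod
      (Measure.pi fun _ : Fin n => gaussianReal 0 1))
    (fun _ => measurePreserving_arrowProdEquivProdArrow ℝ ℝ (Fin n) (fun _ => gaussianReal 0 1)
      (fun _ => gaussianReal 0 1))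
  have h2 := measurePreserving_arrowProdEquivProdArrow (Fin n → ℝ) (Fin n → ℝ) (Fin n)
    (fun _ => Measure.pi fun _ : Fin n => gaussianReal 0 1)
    (fun _ => Measure.pi fun _ : Fin n => gaussianReal 0 1)
  exact h2.comp h1

/-- The pair of coordinates at position `p` of two arrays. -/
def coordPair {n : ℕ} (p : Fin n × Fin n) (ω : (Fin n → Fin n → ℝ) × (Fin n → Fin n → ℝ)) : ℝ × ℝ :=
  (ω.1 p.1 p.2, ω.2 p.1 p.2)

lemma measurable_coordPair {n : ℕ} (p : Fin n × Fin n) : Measurable (coordPair p) := by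
  unfold coordPair
  fun_prop

lemma iIndepFun_coordPair (n : ℕ) :
    iIndepFun (coordPair (n := n)) ((gaussianArray n).prod (gaussianArray n)) := by
  have hΘ := measurePreserving_unzip_array n
  have h := iIndepFun_pi_pi (n := n) ((gaussianReal 0 1).prod (gaussianReal 0 1))
  rw [iIndepFun_iff_map_fun_eq_infinitePi_map measurable_coordPair]
  rw [iIndepFun_iff_map_fun_eq_infinitePi_map (by fun_prop)] at h
  rw [← hΘ.map_eq, Measure.map_map (measurable_pi_lambda _ measurable_coordPair) hΘ.measurable]
  simp only [Measure.map_map (measurable_coordPair _) hΘ.measurable]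
  exact h

/-- Expectations factor over the blocks formed by opposite positions. -/
lemma integral_prod_blocks {n : ℕ} (G : Fin n × Fin n → ℝ × ℝ → ℝ × ℝ → ℂ)
    (hG : ∀ p, Measurable (Function.uncurry (G p))) (hlow : ∀ p, p.2 < p.1 → G p = fun _ _ => 1) :
    ∫ ω, ∏ p, G p (coordPair p ω) (coordPair p.swap ω)
      ∂((gaussianArray n).prod (gaussianArray n)) =
    ∏ p, ∫ ω, G p (coordPair p ω) (coordPair p.swap ω)
      ∂((gaussianArray n).prod (gaussianArray n)) := by
  -- Sending a position to its representative on or above the diagonal makes the fibers exactly the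
  -- blocks. A position strictly below the diagonal has an empty fiber, and its factor is the
  -- constant 1.
  let f : Fin n × Fin n → Fin n × Fin n := fun p => (min p.1 p.2, max p.1 p.2)
  have hf1 : ∀ p : Fin n × Fin n, p.1 ≤ p.2 → f p = p := fun p hp => by simp [f, hp]
  have hf2 : ∀ p : Fin n × Fin n, p.1 ≤ p.2 → f p.swap = p := fun p hp => by simp [f, hp]
  have h := iIndepFun_fibers measurable_coordPair (iIndepFun_coordPair n) f
  let F : ∀ p : Fin n × Fin n, ({q // f q = p} → ℝ × ℝ) → ℂ := fun p x =>
    if hp : p.1 ≤ p.2 then G p (x ⟨p, hf1 p hp⟩) (x ⟨p.swap, hf2 p hp⟩) else 1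
  have hF : ∀ p, Measurable (F p) := fun p => by
    by_cases hp : p.1 ≤ p.2
    · simp only [F, hp, dite_true]
      have hpair : Measurable fun x : {q // f q = p} → ℝ × ℝ =>
          (x ⟨p, hf1 p hp⟩, x ⟨p.swap, hf2 p hp⟩) := by fun_prop
      exact (hG p).comp hpair
    · simp only [F, hp, dite_false]
      exact measurable_const
  have hFG : ∀ p ω, G p (coordPair p ω) (coordPair p.swap ω) =
      F p (fun x => coordPair x ω) := fun p ω => by
    by_cases hp : p.1 ≤ p.2
    · simp only [F, hp, dite_true]
    · simp only [F, hp, dite_false, hlow p (not_le.1 hp)]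
  simp only [hFG]
  exact h.integral_fun_prod_comp
    (fun p => (measurable_pi_lambda _ fun x => measurable_coordPair _).aemeasurable)
    (fun p => (hF p).aestronglyMeasurable)

lemma measurePreserving_eval_pair {n : ℕ} {i j : Fin n} (hij : i ≠ j) :
    MeasurePreserving (fun g : Fin n → Fin n → ℝ => (g i j, g j i)) (gaussianArray n)
      ((gaussianReal 0 1).prod (gaussianReal 0 1)) := by
  have h1 : MeasurePreserving (fun g : Fin n → Fin n → ℝ => (g i, g j)) (gaussianArray n)
      ((Measure.pi fun _ : Fin n => gaussianReal 0 1).prod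
        (Measure.pi fun _ : Fin n => gaussianReal 0 1)) := by
    refine ⟨by fun_prop, ?_⟩
    have := Measure.infinitePi_map_eval_prod
      (P := fun _ : Fin n => Measure.pi fun _ : Fin n => gaussianReal 0 1) hij
    rwa [Measure.infinitePi_eq_pi] at this
  exact ((measurePreserving_eval (fun _ : Fin n => gaussianReal 0 1) j).prod
    (measurePreserving_eval (fun _ : Fin n => gaussianReal 0 1) i)).comp h1

lemma measurePreserving_eval_diag {n : ℕ} (i : Fin n) :
    MeasurePreserving (fun g : Fin n → Fin n → ℝ => g i i) (gaussianArray n) (gaussianReal 0 1) :=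
  (measurePreserving_eval (fun _ : Fin n => gaussianReal 0 1) i).comp
    (measurePreserving_eval (fun _ : Fin n => Measure.pi fun _ : Fin n => gaussianReal 0 1) i)

end Independence

/-! ### Matrix entries as functions of the underlying Gaussian coordinates. -/

section Entries

/-- The entry above the diagonal, from the two pairs of coordinates of its block. -/
def upperEntry (t : ℝ) (a b : ℝ × ℝ) : ℂ :=
  ((√((1 + t) / 2) : ℝ) : ℂ) * complexGaussian (a.1, b.1) +
    Complex.I * ((√((1 - t) / 2) : ℝ) : ℂ) * complexGaussian (a.2, b.2)

/-- The entry below the diagonal, from the two pairs of coordinates of its block. -/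
def lowerEntry (t : ℝ) (a b : ℝ × ℝ) : ℂ :=
  ((√((1 + t) / 2) : ℝ) : ℂ) * (starRingEnd ℂ) (complexGaussian (a.1, b.1)) +
    Complex.I * ((√((1 - t) / 2) : ℝ) : ℂ) * (starRingEnd ℂ) (complexGaussian (a.2, b.2))

/-- The diagonal entry, from its pair of coordinates. -/
def diagEntry (t : ℝ) (a : ℝ × ℝ) : ℂ :=
  ((√((1 + t) / 2) : ℝ) : ℂ) * (a.1 : ℂ) + Complex.I * ((√((1 - t) / 2) : ℝ) : ℂ) * (a.2 : ℂ)

lemma measurable_upperEntry (t : ℝ) :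
    Measurable fun x : (ℝ × ℝ) × (ℝ × ℝ) => upperEntry t x.1 x.2 := by
  unfold upperEntry complexGaussian
  fun_prop

lemma measurable_lowerEntry (t : ℝ) :
    Measurable fun x : (ℝ × ℝ) × (ℝ × ℝ) => lowerEntry t x.1 x.2 := by
  have h : Measurable (starRingEnd ℂ) := Complex.continuous_conj.measurable
  unfold lowerEntry complexGaussian
  fun_prop

lemma measurable_diagEntry (t : ℝ) : Measurable (diagEntry t) := by
  unfold diagEntry
  fun_prop

/-- The elliptic Ginibre matrix as a function of the two Gaussian arrays. -/
def egeMatrix (n : ℕ) (t : ℝ) (ω : (Fin n → Fin n → ℝ) × (Fin n → Fin n → ℝ)) :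
    Matrix (Fin n) (Fin n) ℂ :=
  ellipticCombination n t (hermitianOfReal n ω.1, hermitianOfReal n ω.2)

lemma measurable_egeMatrix (n : ℕ) (t : ℝ) : Measurable (egeMatrix n t) :=
  (measurable_ellipticCombination n t).comp
    (((measurable_hermitianOfReal n).comp measurable_fst).prodMk
      ((measurable_hermitianOfReal n).comp measurable_snd))

lemma egeLaw_eq_map (n : ℕ) (t : ℝ) :
    egeLaw n t = ((gaussianArray n).prod (gaussianArray n)).map (egeMatrix n t) := by
  rw [egeLaw, gueLaw, Measure.map_prod_map _ _ (measurable_hermitianOfReal n)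
    (measurable_hermitianOfReal n), Measure.map_map (measurable_ellipticCombination n t)
    ((measurable_hermitianOfReal n).prodMap (measurable_hermitianOfReal n))]
  rfl

variable {n : ℕ} (t : ℝ) (ω : (Fin n → Fin n → ℝ) × (Fin n → Fin n → ℝ))

lemma egeMatrix_of_lt {i j : Fin n} (h : i < j) :
    egeMatrix n t ω i j = upperEntry t (coordPair (i, j) ω) (coordPair (j, i) ω) := by
  simp [egeMatrix, ellipticCombination, hermitianOfReal, h, upperEntry, coordPair,
    complexGaussian]

lemma egeMatrix_of_gt {i j : Fin n} (h : i < j) :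
    egeMatrix n t ω j i = lowerEntry t (coordPair (i, j) ω) (coordPair (j, i) ω) := by
  simp [egeMatrix, ellipticCombination, hermitianOfReal, h, lowerEntry, coordPair, h.not_gt,
    complexGaussian, sub_eq_add_neg]

lemma egeMatrix_diag (i : Fin n) :
    egeMatrix n t ω i i = diagEntry t (coordPair (i, i) ω) := by
  simp [egeMatrix, ellipticCombination, hermitianOfReal, diagEntry, coordPair]

end Entries

/-! ### Mixed moments of a single block. -/

section BlockMoments

lemma sq_sqrt_half {t : ℝ} (h0 : -1 ≤ t) (h1 : t ≤ 1) :
    ((√((1 + t) / 2) : ℝ) : ℂ) ^ 2 = (1 + t) / 2 ∧ ((√((1 - t) / 2) : ℝ) : ℂ) ^ 2 = (1 - t) / 2 := by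
  constructor
  · rw [← Complex.ofReal_pow, Real.sq_sqrt (by linarith)]; push_cast; ring
  · rw [← Complex.ofReal_pow, Real.sq_sqrt (by linarith)]; push_cast; ring

/-- With `α² = (1+t)/2` and `β² = (1-t)/2`, one has `α² + β² = 1` and `α² - β² = t`. These give each
entry unit second absolute moment and the product of opposite entries mean `t`. The extra term `p₃
q₃` is the covariance of that product with its conjugate. -/
lemma integral_pairBlock {t : ℝ} (h0 : -1 ≤ t) (h1 : t ≤ 1) {n : ℕ} {i j : Fin n} (hij : i < j)
    (p₀ p₁ p₂ p₃ q₀ q₁ q₂ q₃ : ℂ) :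
    ∫ ω, (p₀ + p₁ * egeMatrix n t ω i j + p₂ * egeMatrix n t ω j i +
        p₃ * (egeMatrix n t ω i j * egeMatrix n t ω j i)) *
      (q₀ + q₁ * (starRingEnd ℂ) (egeMatrix n t ω i j) +
        q₂ * (starRingEnd ℂ) (egeMatrix n t ω j i) +
        q₃ * ((starRingEnd ℂ) (egeMatrix n t ω i j) * (starRingEnd ℂ) (egeMatrix n t ω j i)))
      ∂((gaussianArray n).prod (gaussianArray n)) =
    (p₀ + t * p₃) * (q₀ + t * q₃) + p₁ * q₁ + p₂ * q₂ + p₃ * q₃ := by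
  obtain ⟨ha, hb⟩ := sq_sqrt_half h0 h1
  set α : ℂ := ((√((1 + t) / 2) : ℝ) : ℂ) with hα
  set β : ℂ := ((√((1 - t) / 2) : ℝ) : ℂ) with hβ
  have hαc : (starRingEnd ℂ) α = α := Complex.conj_ofReal _
  have hβc : (starRingEnd ℂ) β = β := Complex.conj_ofReal _
  set ρ := (gaussianReal 0 1).prod (gaussianReal 0 1) with hρ
  let Z := complexGaussian
  let A : (ℝ × ℝ) × (ℝ × ℝ) → ℂ := fun x => α * Z x.1 + Complex.I * β * Z x.2
  let B : (ℝ × ℝ) × (ℝ × ℝ) → ℂ := fun x =>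
    α * (starRingEnd ℂ) (Z x.1) + Complex.I * β * (starRingEnd ℂ) (Z x.2)
  let Φ : (ℝ × ℝ) × (ℝ × ℝ) → ℂ := fun x =>
    (p₀ + p₁ * A x + p₂ * B x + p₃ * (A x * B x)) *
      (q₀ + q₁ * (starRingEnd ℂ) (A x) + q₂ * (starRingEnd ℂ) (B x) +
        q₃ * ((starRingEnd ℂ) (A x) * (starRingEnd ℂ) (B x)))
  have mZ := allMoments_complexGaussian
  have mZ1 : AllMoments (fun x : (ℝ × ℝ) × (ℝ × ℝ) => Z x.1) (ρ.prod ρ) :=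
    mZ.comp_measurePreserving measurePreserving_fst
  have mZ2 : AllMoments (fun x : (ℝ × ℝ) × (ℝ × ℝ) => Z x.2) (ρ.prod ρ) :=
    mZ.comp_measurePreserving measurePreserving_snd
  have mA : AllMoments A (ρ.prod ρ) := (mZ1.const_mul _).add (mZ2.const_mul _)
  have mB : AllMoments B (ρ.prod ρ) := (mZ1.conj.const_mul _).add (mZ2.conj.const_mul _)
  have mΦ : AllMoments Φ (ρ.prod ρ) :=
    ((((AllMoments.const _).add (mA.const_mul _)).add (mB.const_mul _)).add
      ((mA.mul mB).const_mul _)).mul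
    ((((AllMoments.const _).add (mA.conj.const_mul _)).add (mB.conj.const_mul _)).add
      ((mA.conj.mul mB.conj).const_mul _))
  have hΘ : MeasurePreserving (fun ω : (Fin n → Fin n → ℝ) × (Fin n → Fin n → ℝ) =>
      ((ω.1 i j, ω.1 j i), (ω.2 i j, ω.2 j i))) ((gaussianArray n).prod (gaussianArray n))
      (ρ.prod ρ) :=
    (measurePreserving_eval_pair hij.ne).prod (measurePreserving_eval_pair hij.ne)
  have e1 : ∀ ω, egeMatrix n t ω i j = A ((ω.1 i j, ω.1 j i), (ω.2 i j, ω.2 j i)) := fun ω =>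
    egeMatrix_of_lt t ω hij
  have e2 : ∀ ω, egeMatrix n t ω j i = B ((ω.1 i j, ω.1 j i), (ω.2 i j, ω.2 j i)) := fun ω =>
    egeMatrix_of_gt t ω hij
  simp only [e1, e2]
  have e3 : ∫ ω, Φ ((ω.1 i j, ω.1 j i), (ω.2 i j, ω.2 j i))
      ∂((gaussianArray n).prod (gaussianArray n)) = ∫ x, Φ x ∂(ρ.prod ρ) := by
    rw [← hΘ.map_eq, integral_map hΘ.measurable.aemeasurable]
    rw [hΘ.map_eq]
    exact mΦ.integrable.aestronglyMeasurable
  refine e3.trans ?_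
  rw [integral_prod _ mΦ.integrable]
  -- With the Gaussian of the first Hermitian matrix frozen, the integrand is biaffine in the second
  -- one. Its four resulting terms are written, with zero coefficients where needed, as biaffine
  -- products in the first Gaussian plus a constant, so that the same moment formula applies again.
  have inner : ∀ x, ∫ y, Φ (x, y) ∂ρ =
      ((p₀ - β ^ 2 * p₃) + α * p₁ * Z x + α * p₂ * (starRingEnd ℂ) (Z x) +
        α ^ 2 * p₃ * (Z x * (starRingEnd ℂ) (Z x))) *
      ((q₀ - β ^ 2 * q₃) + α * q₁ * (starRingEnd ℂ) (Z x) + α * q₂ * Z x +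
        α ^ 2 * q₃ * (Z x * (starRingEnd ℂ) (Z x))) +
      (Complex.I * β * p₁ + 0 * Z x + Complex.I * α * β * p₃ * (starRingEnd ℂ) (Z x) +
        0 * (Z x * (starRingEnd ℂ) (Z x))) *
      (-Complex.I * β * q₁ + 0 * (starRingEnd ℂ) (Z x) + -Complex.I * α * β * q₃ * Z x +
        0 * (Z x * (starRingEnd ℂ) (Z x))) +
      (Complex.I * β * p₂ + Complex.I * α * β * p₃ * Z x + 0 * (starRingEnd ℂ) (Z x) +
        0 * (Z x * (starRingEnd ℂ) (Z x))) *
      (-Complex.I * β * q₂ + -Complex.I * α * β * q₃ * (starRingEnd ℂ) (Z x) + 0 * Z x +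
        0 * (Z x * (starRingEnd ℂ) (Z x))) +
      β ^ 2 * p₃ * (β ^ 2 * q₃) := by
    intro x
    have h := integral_biaffine_complexGaussian
      (p₀ + α * (p₁ * Z x + p₂ * (starRingEnd ℂ) (Z x)) + p₃ * α ^ 2 * (Z x * (starRingEnd ℂ) (Z x)))
      (Complex.I * β * p₁ + Complex.I * α * β * p₃ * (starRingEnd ℂ) (Z x))
      (Complex.I * β * p₂ + Complex.I * α * β * p₃ * Z x) (-β ^ 2 * p₃)
      (q₀ + α * (q₁ * (starRingEnd ℂ) (Z x) + q₂ * Z x) + q₃ * α ^ 2 * (Z x * (starRingEnd ℂ) (Z x)))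
      (-Complex.I * β * q₁ + -Complex.I * α * β * q₃ * Z x)
      (-Complex.I * β * q₂ + -Complex.I * α * β * q₃ * (starRingEnd ℂ) (Z x)) (-β ^ 2 * q₃)
    rw [integral_congr_ae (g := _) (Filter.Eventually.of_forall fun y => ?_)]
    · refine h.trans ?_
      ring
    · simp only [Φ, A, B, map_add, map_mul, Complex.conj_I, hαc, hβc, Complex.conj_conj, Z]
      generalize complexGaussian x = X
      generalize complexGaussian y = Y
      generalize (starRingEnd ℂ) X = X'
      generalize (starRingEnd ℂ) Y = Y'
      have hI : Complex.I ^ 2 = -1 := Complex.I_sq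
      congr 1
      · linear_combination p₃ * β ^ 2 * Y * Y' * hI
      · linear_combination q₃ * β ^ 2 * Y * Y' * hI
  simp only [inner]
  have mq : ∀ a b c d a' b' c' d' : ℂ, AllMoments (fun x =>
      (a + b * Z x + c * (starRingEnd ℂ) (Z x) + d * (Z x * (starRingEnd ℂ) (Z x))) *
      (a' + b' * (starRingEnd ℂ) (Z x) + c' * Z x + d' * (Z x * (starRingEnd ℂ) (Z x)))) ρ :=
    fun a b c d a' b' c' d' =>
    ((((AllMoments.const _).add (mZ.const_mul _)).add (mZ.conj.const_mul _)).add
      ((mZ.mul mZ.conj).const_mul _)).mul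
    ((((AllMoments.const _).add (mZ.conj.const_mul _)).add (mZ.const_mul _)).add
      ((mZ.mul mZ.conj).const_mul _))
  rw [integral_add (((mq _ _ _ _ _ _ _ _).add (mq _ _ _ _ _ _ _ _)).add
      (mq _ _ _ _ _ _ _ _)).integrable (integrable_const _),
    integral_add ((mq _ _ _ _ _ _ _ _).add (mq _ _ _ _ _ _ _ _)).integrable
      (mq _ _ _ _ _ _ _ _).integrable,
    integral_add (mq _ _ _ _ _ _ _ _).integrable (mq _ _ _ _ _ _ _ _).integrable,
    integral_biaffine_complexGaussian, integral_biaffine_complexGaussian,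
    integral_biaffine_complexGaussian]
  simp only [integral_const, probReal_univ, one_smul]
  have hI : Complex.I ^ 2 = -1 := Complex.I_sq
  linear_combination (-2 * β ^ 2 * α ^ 2 * p₃ * q₃ - β ^ 2 * p₁ * q₁ - β ^ 2 * p₂ * q₂) * hI +
    (p₀ * q₃ + p₃ * q₀) * (ha - hb) + (p₁ * q₁ + p₂ * q₂) * (ha + hb) +
    p₃ * q₃ * (2 * (α ^ 2 + (1 + t) / 2) * ha + 2 * (β ^ 2 + (1 - t) / 2) * hb)

lemma integral_diagBlock {t : ℝ} (h0 : -1 ≤ t) (h1 : t ≤ 1) {n : ℕ} (i : Fin n)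
    (p₀ p₁ q₀ q₁ : ℂ) :
    ∫ ω, (p₀ + p₁ * egeMatrix n t ω i i) * (q₀ + q₁ * (starRingEnd ℂ) (egeMatrix n t ω i i))
      ∂((gaussianArray n).prod (gaussianArray n)) = p₀ * q₀ + p₁ * q₁ := by
  obtain ⟨ha, hb⟩ := sq_sqrt_half h0 h1
  set α : ℂ := ((√((1 + t) / 2) : ℝ) : ℂ) with hα
  set β : ℂ := ((√((1 - t) / 2) : ℝ) : ℂ) with hβ
  have hαc : (starRingEnd ℂ) α = α := Complex.conj_ofReal _
  have hβc : (starRingEnd ℂ) β = β := Complex.conj_ofReal _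
  set γ := gaussianReal 0 1 with hγ
  let A : ℝ × ℝ → ℂ := fun x => α * x.1 + Complex.I * β * x.2
  have mA : AllMoments A (γ.prod γ) :=
    ((allMoments_gaussianReal.comp_measurePreserving measurePreserving_fst).const_mul _).add
      ((allMoments_gaussianReal.comp_measurePreserving measurePreserving_snd).const_mul _)
  let Φ : ℝ × ℝ → ℂ := fun x => (p₀ + p₁ * A x) * (q₀ + q₁ * (starRingEnd ℂ) (A x))
  have mΦ : AllMoments Φ (γ.prod γ) :=
    ((AllMoments.const _).add (mA.const_mul _)).mul ((AllMoments.const _).add (mA.conj.const_mul _))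
  have hΘ : MeasurePreserving (fun ω : (Fin n → Fin n → ℝ) × (Fin n → Fin n → ℝ) =>
      (ω.1 i i, ω.2 i i)) ((gaussianArray n).prod (gaussianArray n)) (γ.prod γ) :=
    (measurePreserving_eval_diag i).prod (measurePreserving_eval_diag i)
  have e1 : ∀ ω, egeMatrix n t ω i i = A (ω.1 i i, ω.2 i i) := fun ω => egeMatrix_diag t ω i
  simp only [e1]
  have e3 : ∫ ω, Φ (ω.1 i i, ω.2 i i) ∂((gaussianArray n).prod (gaussianArray n)) =
      ∫ x, Φ x ∂(γ.prod γ) := by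
    rw [← hΘ.map_eq, integral_map hΘ.measurable.aemeasurable]
    rw [hΘ.map_eq]
    exact mΦ.integrable.aestronglyMeasurable
  refine e3.trans ?_
  rw [integral_prod _ mΦ.integrable]
  have hI : Complex.I ^ 2 = -1 := Complex.I_sq
  rw [integral_quartic_gaussianReal (p₀ * q₀ + β ^ 2 * p₁ * q₁) (α * (p₀ * q₁ + p₁ * q₀))
    (α ^ 2 * p₁ * q₁) 0 0]
  · linear_combination (p₁ * q₁) * (ha + hb)
  intro x
  rw [integral_quartic_gaussianReal ((p₀ + p₁ * (α * x)) * (q₀ + q₁ * (α * x)))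
    (Complex.I * β * p₁ * (q₀ + q₁ * (α * x)) - Complex.I * β * q₁ * (p₀ + p₁ * (α * x)))
    (β ^ 2 * p₁ * q₁) 0 0]
  · ring
  intro y
  simp only [Φ, A, map_add, map_mul, Complex.conj_I, hαc, hβc, Complex.conj_ofReal]
  linear_combination (- p₁ * q₁ * β ^ 2 * y ^ 2) * hI

end BlockMoments

/-! ### The second moment of the characteristic polynomial. -/

section SecondMoment

lemma prod_eq_diag_mul_upper {ι : Type*} [Fintype ι] [LinearOrder ι] {R : Type*} [CommMonoid R]
    (f : ι → ι → R) :
    ∏ i, ∏ j, f i j = (∏ i, f i i) * ∏ p ∈ upperPairs ι, f p.1 p.2 * f p.2 p.1 := by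
  have h1 : ∀ i j, f i j = (if i = j then f i j else 1) *
      ((if i < j then f i j else 1) * (if j < i then f i j else 1)) := fun i j => by
    rcases lt_trichotomy i j with h | h | h
    · simp [h, h.ne, h.not_gt]
    · simp [h]
    · simp [h, h.ne', h.not_gt]
  have h2 : ∀ g : ι → ι → R, ∏ i, ∏ j, (if i < j then g i j else 1) =
      ∏ p ∈ upperPairs ι, g p.1 p.2 := fun g => by
    rw [upperPairs, Finset.prod_filter, Fintype.prod_prod_type]
  rw [Finset.prod_congr rfl fun i _ => Finset.prod_congr rfl fun j _ => h1 i j]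
  simp only [Finset.prod_mul_distrib, Finset.prod_ite_eq, Finset.mem_univ, if_true]
  rw [h2, Finset.prod_comm (f := fun i j => if j < i then f i j else 1), h2 fun i j => f j i]

lemma prod_perm_eq_blocks {ι : Type*} [Fintype ι] [LinearOrder ι] {R : Type*} [CommMonoid R]
    (M : ι → ι → R) (σ : Equiv.Perm ι) :
    ∏ i, M i (σ i) = (∏ i, if σ i = i then M i i else 1) * ∏ p ∈ upperPairs ι,
      (if σ p.1 = p.2 then M p.1 p.2 else 1) * (if σ p.2 = p.1 then M p.2 p.1 else 1) := by
  rw [← prod_eq_diag_mul_upper fun i j => if σ i = j then M i j else 1]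
  simp

variable {n : ℕ} {t : ℝ}

lemma allMoments_egeMatrix (i j : Fin n) :
    AllMoments (fun ω => egeMatrix n t ω i j) ((gaussianArray n).prod (gaussianArray n)) := by
  have hg : ∀ i j, AllMoments (fun g : Fin n → Fin n → ℝ => (g i j : ℂ)) (gaussianArray n) :=
    fun i j => allMoments_gaussianReal.comp_measurePreserving
      ((measurePreserving_eval (fun _ : Fin n => gaussianReal 0 1) j).comp
        (measurePreserving_eval (fun _ : Fin n => Measure.pi fun _ : Fin n => gaussianReal 0 1) i))
  have hH : AllMoments (fun g => hermitianOfReal n g i j) (gaussianArray n) := by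
    rcases lt_trichotomy i j with h | h | h
    · simp only [hermitianOfReal, Matrix.of_apply, h, if_true, div_eq_inv_mul]
      exact ((hg i j).add ((hg j i).const_mul _)).const_mul _
    · simp only [hermitianOfReal, Matrix.of_apply, h, lt_irrefl, if_false]
      exact hg j j
    · simp only [hermitianOfReal, Matrix.of_apply, h, h.not_gt, if_true, if_false, div_eq_inv_mul]
      exact ((hg j i).sub ((hg i j).const_mul _)).const_mul _
  exact ((hH.comp_measurePreserving measurePreserving_fst).const_mul _).add
    ((hH.comp_measurePreserving measurePreserving_snd).const_mul _)

/-- The entries of `u - A`. -/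
def charEntry (n : ℕ) (t : ℝ) (u : ℂ) (ω : (Fin n → Fin n → ℝ) × (Fin n → Fin n → ℝ))
    (i j : Fin n) : ℂ :=
  (if i = j then u else 0) - egeMatrix n t ω i j

lemma allMoments_charEntry (u : ℂ) (i j : Fin n) :
    AllMoments (fun ω => charEntry n t u ω i j) ((gaussianArray n).prod (gaussianArray n)) :=
  (AllMoments.const _).sub (allMoments_egeMatrix i j)

lemma det_eq_sum_charEntry (u : ℂ) (ω : (Fin n → Fin n → ℝ) × (Fin n → Fin n → ℝ)) :
    (u • (1 : Matrix (Fin n) (Fin n) ℂ) - egeMatrix n t ω).det =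
      ∑ σ : Equiv.Perm (Fin n), ((Equiv.Perm.sign σ : ℤ) : ℂ) * ∏ i, charEntry n t u ω i (σ i) := by
  -- Transposing turns the product over entries `(σ i, i)` into one over `(i, σ i)`, the convention
  -- of the block sums.
  rw [← Matrix.det_transpose, Matrix.det_apply']
  refine Finset.sum_congr rfl fun σ _ => ?_
  congr 1
  refine Finset.prod_congr rfl fun i _ => ?_
  simp [charEntry, Matrix.one_apply, mul_ite]

/-- The part of the terms of `σ` and `τ` that lives on the block at position `p`. -/
def blockFactor (t : ℝ) (u : ℂ) (σ τ : Equiv.Perm (Fin n)) (p : Fin n × Fin n) (a b : ℝ × ℝ) : ℂ :=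
  if p.1 = p.2 then
    (if σ p.1 = p.1 then u - diagEntry t a else 1) *
      (if τ p.1 = p.1 then (starRingEnd ℂ) (u - diagEntry t a) else 1)
  else if p.1 < p.2 then
    ((if σ p.1 = p.2 then -upperEntry t a b else 1) *
      (if σ p.2 = p.1 then -lowerEntry t a b else 1)) *
    ((if τ p.1 = p.2 then (starRingEnd ℂ) (-upperEntry t a b) else 1) *
      (if τ p.2 = p.1 then (starRingEnd ℂ) (-lowerEntry t a b) else 1))
  else 1

lemma measurable_blockFactor (t : ℝ) (u : ℂ) (σ τ : Equiv.Perm (Fin n)) (p : Fin n × Fin n) :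
    Measurable (Function.uncurry (blockFactor t u σ τ p)) := by
  have hc : Measurable (starRingEnd ℂ) := Complex.continuous_conj.measurable
  have h1 := measurable_upperEntry t
  have h2 := measurable_lowerEntry t
  have h3 : Measurable fun x : (ℝ × ℝ) × (ℝ × ℝ) => diagEntry t x.1 :=
    (measurable_diagEntry t).comp measurable_fst
  unfold Function.uncurry blockFactor
  split_ifs <;> fun_prop

/-- Each entry used by `σ` or `τ` belongs to exactly one block, so the product of two determinant
terms regroups into functions of independent variables. -/
lemma prod_blockFactor (u : ℂ) (σ τ : Equiv.Perm (Fin n))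
    (ω : (Fin n → Fin n → ℝ) × (Fin n → Fin n → ℝ)) :
    ∏ p, blockFactor t u σ τ p (coordPair p ω) (coordPair p.swap ω) =
      (∏ i, charEntry n t u ω i (σ i)) *
        ∏ i, (starRingEnd ℂ) (charEntry n t u ω i (τ i)) := by
  rw [prod_perm_eq_blocks (charEntry n t u ω) σ,
    prod_perm_eq_blocks (fun i j => (starRingEnd ℂ) (charEntry n t u ω i j)) τ,
    Fintype.prod_prod_type, prod_eq_diag_mul_upper fun i j =>
      blockFactor t u σ τ (i, j) (coordPair (i, j) ω) (coordPair (i, j).swap ω),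
    mul_mul_mul_comm, ← Finset.prod_mul_distrib, ← Finset.prod_mul_distrib]
  congr 1
  · refine Finset.prod_congr rfl fun i _ => ?_
    simp [blockFactor, charEntry, egeMatrix_diag]
  · refine Finset.prod_congr rfl fun p hp => ?_
    obtain ⟨i, j⟩ := p
    have h : i < j := mem_upperPairs.1 hp
    simp [blockFactor, charEntry, h, h.ne, h.ne', h.not_gt, egeMatrix_of_lt t ω h,
      egeMatrix_of_gt t ω h]

lemma integral_blockFactor_diag (h0 : -1 ≤ t) (h1 : t ≤ 1) (u : ℂ) (σ τ : Equiv.Perm (Fin n))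
    (i : Fin n) :
    ∫ ω, blockFactor t u σ τ (i, i) (coordPair (i, i) ω) (coordPair (i, i).swap ω)
      ∂((gaussianArray n).prod (gaussianArray n)) =
    diagWeight u ((starRingEnd ℂ) u) (σ i = i) (τ i = i) := by
  have h := fun a b c d => integral_diagBlock h0 h1 i a b c d
  simp only [blockFactor, if_true, ← egeMatrix_diag]
  by_cases a : σ i = i <;> by_cases b : τ i = i <;> simp only [a, b, if_true, if_false, diagWeight]
  · simpa [sub_eq_add_neg] using h u (-1) ((starRingEnd ℂ) u) (-1)
  · simpa [sub_eq_add_neg] using h u (-1) 1 0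
  · simpa [sub_eq_add_neg] using h 1 0 ((starRingEnd ℂ) u) (-1)
  · simp

lemma integral_blockFactor_upper (h0 : -1 ≤ t) (h1 : t ≤ 1) (u : ℂ) (σ τ : Equiv.Perm (Fin n))
    {p : Fin n × Fin n} (hp : p.1 < p.2) :
    ∫ ω, blockFactor t u σ τ p (coordPair p ω) (coordPair p.swap ω)
      ∂((gaussianArray n).prod (gaussianArray n)) =
    pairWeight (t : ℂ) (t : ℂ) (σ p.1 = p.2) (σ p.2 = p.1) (τ p.1 = p.2) (τ p.2 = p.1) := by
  obtain ⟨i, j⟩ := p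
  have hij : i < j := hp
  -- The coefficients select one monomial for `σ` and one for `τ`: neither entry, one of them with
  -- its sign from `u - A`, or both, where the signs cancel.
  have h := integral_pairBlock h0 h1 hij
    (if σ i = j then 0 else if σ j = i then 0 else 1)
    (if σ i = j then (if σ j = i then 0 else -1) else 0)
    (if σ i = j then 0 else if σ j = i then -1 else 0)
    (if σ i = j then (if σ j = i then 1 else 0) else 0)
    (if τ i = j then 0 else if τ j = i then 0 else 1)
    (if τ i = j then (if τ j = i then 0 else -1) else 0)
    (if τ i = j then 0 else if τ j = i then -1 else 0)
    (if τ i = j then (if τ j = i then 1 else 0) else 0)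
  refine Eq.trans (integral_congr_ae (Filter.Eventually.of_forall fun ω => ?_)) (h.trans ?_)
  · simp only [blockFactor, hij, hij.ne, if_true, if_false, ← egeMatrix_of_lt t ω hij,
      ← egeMatrix_of_gt t ω hij, Prod.swap]
    by_cases a : σ i = j <;> by_cases b : σ j = i <;> by_cases c : τ i = j <;>
      by_cases d : τ j = i <;> simp [a, b, c, d]
  · by_cases a : σ i = j <;> by_cases b : σ j = i <;> by_cases c : τ i = j <;>
      by_cases d : τ j = i <;> simp [pairWeight, pairMean, a, b, c, d]

/-- The second moment of the characteristic polynomial, in terms of the Hermite kernel. -/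
theorem integral_normSq_charpoly (h0 : -1 ≤ t) (h1 : t ≤ 1) (u : ℂ) :
    ∫ ω, (u • (1 : Matrix (Fin n) (Fin n) ℂ) - egeMatrix n t ω).det *
      (starRingEnd ℂ) (u • (1 : Matrix (Fin n) (Fin n) ℂ) - egeMatrix n t ω).det
      ∂((gaussianArray n).prod (gaussianArray n)) =
    hermiteSum n (t : ℂ) t u ((starRingEnd ℂ) u) := by
  have key := covSum_eq_hermiteSum (Fin n) (t : ℂ) t u ((starRingEnd ℂ) u)
  rw [Fintype.card_fin] at key
  rw [← key, covSum]
  simp only [det_eq_sum_charEntry, map_sum, map_mul, map_prod, Finset.sum_mul_sum]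
  have mprod : ∀ σ : Equiv.Perm (Fin n), AllMoments (fun ω => ∏ i, charEntry n t u ω i (σ i))
      ((gaussianArray n).prod (gaussianArray n)) := fun σ =>
    AllMoments.finset_prod _ fun i _ => allMoments_charEntry u i (σ i)
  have mterm : ∀ σ τ : Equiv.Perm (Fin n), AllMoments (fun ω =>
      (((Equiv.Perm.sign σ : ℤ) : ℂ) * ∏ i, charEntry n t u ω i (σ i)) *
      ((starRingEnd ℂ) ((Equiv.Perm.sign τ : ℤ) : ℂ) *
        ∏ i, (starRingEnd ℂ) (charEntry n t u ω i (τ i))))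
      ((gaussianArray n).prod (gaussianArray n)) := fun σ τ =>
    ((mprod σ).const_mul _).mul ((AllMoments.finset_prod _ fun i _ =>
      (allMoments_charEntry u i (τ i)).conj).const_mul _)
  rw [integral_finsetSum _ fun σ _ =>
    (AllMoments.finset_sum _ fun τ _ => mterm σ τ).integrable]
  refine Finset.sum_congr rfl fun σ _ => ?_
  rw [integral_finsetSum _ fun τ _ => (mterm σ τ).integrable]
  refine Finset.sum_congr rfl fun τ _ => ?_
  have e1 : ∀ ω, (((Equiv.Perm.sign σ : ℤ) : ℂ) * ∏ i, charEntry n t u ω i (σ i)) *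
      ((starRingEnd ℂ) ((Equiv.Perm.sign τ : ℤ) : ℂ) *
        ∏ i, (starRingEnd ℂ) (charEntry n t u ω i (τ i))) =
      ((Equiv.Perm.sign σ : ℤ) : ℂ) * ((Equiv.Perm.sign τ : ℤ) : ℂ) *
      ∏ p, blockFactor t u σ τ p (coordPair p ω) (coordPair p.swap ω) := fun ω => by
    rw [prod_blockFactor, map_intCast]; ring
  simp only [e1]
  rw [integral_const_mul, integral_prod_blocks _ (measurable_blockFactor t u σ τ)
    (fun p hp => by funext a b; simp [blockFactor, hp.ne', hp.not_gt]), Fintype.prod_prod_type,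
    prod_eq_diag_mul_upper fun i j => ∫ ω, blockFactor t u σ τ (i, j) (coordPair (i, j) ω)
      (coordPair (i, j).swap ω) ∂((gaussianArray n).prod (gaussianArray n))]
  congr 2
  · exact Finset.prod_congr rfl fun i _ => integral_blockFactor_diag h0 h1 u σ τ i
  · refine Finset.prod_congr rfl fun p hp => ?_
    have hlt := mem_upperPairs.1 hp
    have e2 : ∀ ω, blockFactor t u σ τ (p.2, p.1) (coordPair (p.2, p.1) ω)
        (coordPair (p.2, p.1).swap ω) = 1 := fun ω => by
      simp [blockFactor, hlt.ne', hlt.not_gt]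
    rw [integral_blockFactor_upper h0 h1 u σ τ hlt]
    simp only [e2, integral_const, probReal_univ, one_smul, mul_one]

/-- The determinant of `c - w A` has moments of all orders. -/
lemma allMoments_det (c w : ℂ) :
    AllMoments (fun ω => (c • (1 : Matrix (Fin n) (Fin n) ℂ) - w • egeMatrix n t ω).det)
      ((gaussianArray n).prod (gaussianArray n)) := by
  simp only [Matrix.det_apply']
  refine AllMoments.finset_sum _ fun σ _ => (AllMoments.finset_prod _ fun i _ => ?_).const_mul _
  exact (AllMoments.const _).sub ((allMoments_egeMatrix (σ i) i).const_mul w)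

end SecondMoment

/-! ### Contour integrals for the rescaled Hermite polynomials, and bounds on them. -/

section Phase

open Complex (I)

/-- The entire function `exp (n (w - a (w - 1)² / 2))`. -/
def phase (n : ℕ) (a w : ℂ) : ℂ := Complex.exp (n * (w - a / 2 * (w - 1) ^ 2))

/-- The Taylor coefficients of `phase n a` at the origin, multiplied by factorials. -/
def scaledHermite (n : ℕ) (a : ℂ) (k : ℕ) : ℂ :=
  hermiteVar (n * a) (n * (1 + a)) k * Complex.exp (-(n * a) / 2)

lemma hasDerivAt_hermiteVar (τ u : ℂ) (k : ℕ) :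
    HasDerivAt (fun u => hermiteVar τ u (k + 1)) ((k + 1) * hermiteVar τ u k) u := by
  induction k using Nat.strong_induction_on with
  | _ k ih =>
    match k with
    | 0 =>
      simp only [hermiteVar]
      convert! hasDerivAt_id u using 1
      simp
    | 1 =>
      simp only [hermiteVar]
      convert! ((hasDerivAt_id u).mul (hasDerivAt_id u)).sub_const
        ((((0 : ℕ) : ℂ) + 1) * τ * 1) using 1
      simp; ring
    | k + 2 =>
      have h1 := ih (k + 1) (by omega)
      have h2 := ih k (by omega)
      have e : hermiteVar τ u (k + 2) = u * hermiteVar τ u (k + 1)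
        - ((k : ℂ) + 1) * τ * hermiteVar τ u k := rfl
      have h3 := ((hasDerivAt_id u).mul h1).sub (h2.const_mul ((((k + 1 : ℕ) : ℂ) + 1) * τ))
      convert! h3 using 1
      rw [show id u = u from rfl, e]
      push_cast
      ring

lemma differentiable_phase (n : ℕ) (a : ℂ) : Differentiable ℂ (phase n a) := by
  unfold phase
  fun_prop

/-- The logarithmic derivative of the phase is affine in `w` with slope `-na`, so each further
differentiation reproduces the Hermite recurrence with variance `na`. -/
lemma iteratedDeriv_phase (n : ℕ) (a : ℂ) (k : ℕ) :
    iteratedDeriv k (phase n a) =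
      fun w => hermiteVar (n * a) (n * (1 + a) - n * a * w) k * phase n a w := by
  have hphase : ∀ w, HasDerivAt (phase n a) ((n * (1 + a) - n * a * w) * phase n a w) w := by
    intro w
    have h1 : HasDerivAt (fun w : ℂ => (n : ℂ) * (w - a / 2 * (w - 1) ^ 2))
        (n * (1 + a) - n * a * w) w := by
      have h2 := (((hasDerivAt_id w).sub_const 1).pow 2).const_mul (a / 2)
      have h3 := ((hasDerivAt_id w).sub h2).const_mul (n : ℂ)
      convert! h3 using 1
      simp
      ring
    rw [mul_comm]
    exact h1.cexp
  have haff : ∀ w : ℂ, HasDerivAt (fun w : ℂ => n * (1 + a) - n * a * w) (-(n * a)) w := by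
    intro w
    convert! ((hasDerivAt_id w).const_mul ((n : ℂ) * a)).const_sub (n * (1 + a)) using 1
    simp
  induction k with
  | zero => ext w; simp [hermiteVar]
  | succ k ih =>
    rw [iteratedDeriv_succ, ih]
    ext w
    match k with
    | 0 =>
      simp only [hermiteVar, one_mul]
      exact (hphase w).deriv
    | k + 1 =>
      have h1 := (hasDerivAt_hermiteVar (n * a) (n * (1 + a) - n * a * w) k).comp w (haff w)
      have h2 := (h1.mul (hphase w)).deriv
      refine h2.trans ?_
      simp only [Function.comp, hermiteVar]
      ring

/-- Cauchy's formula for Taylor coefficients, with the radius left free for later optimisation.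
Periodicity moves the interval to `[-π, π]`, centred at the saddle point `θ = 0`. -/
lemma scaledHermite_eq_integral (n : ℕ) (a : ℂ) (k : ℕ) {R : ℝ} (hR : 0 < R) :
    scaledHermite n a k = (k.factorial / (2 * Real.pi) : ℂ) *
      ∫ θ in (-Real.pi)..Real.pi, (circleMap 0 R θ ^ k)⁻¹ * phase n a (circleMap 0 R θ) := by
  have h := DiffContOnCl.circleIntegral_one_div_sub_center_pow_smul hR k
    (differentiable_phase n a).diffContOnCl (c := 0)
  rw [iteratedDeriv_phase] at h
  have h0 : hermiteVar ((n : ℂ) * a) (n * (1 + a) - n * a * 0) k * phase n a 0 =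
      scaledHermite n a k := by
    rw [scaledHermite, phase]; simp; left; ring_nf
  simp only [h0, smul_eq_mul, circleIntegral, sub_zero, deriv_circleMap] at h
  have hper : ∫ θ in (-Real.pi)..Real.pi,
      (circleMap 0 R θ ^ k)⁻¹ * phase n a (circleMap 0 R θ) =
      ∫ θ in (0 : ℝ)..2 * Real.pi, (circleMap 0 R θ ^ k)⁻¹ * phase n a (circleMap 0 R θ) := by
    have hp : Function.Periodic (fun θ : ℝ =>
        (circleMap 0 R θ ^ k)⁻¹ * phase n a (circleMap 0 R θ)) (2 * Real.pi) := fun θ => by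
      simp only [periodic_circleMap 0 R θ]
    have := hp.intervalIntegral_add_eq (-Real.pi) 0
    simpa [show -Real.pi + 2 * Real.pi = Real.pi by ring] using this
  have hI : ∫ θ in (0 : ℝ)..2 * Real.pi, circleMap 0 R θ * I *
      (1 / circleMap 0 R θ ^ (k + 1) * phase n a (circleMap 0 R θ)) =
      I * ∫ θ in (0 : ℝ)..2 * Real.pi,
        (circleMap 0 R θ ^ k)⁻¹ * phase n a (circleMap 0 R θ) := by
    rw [← intervalIntegral.integral_const_mul]
    refine intervalIntegral.integral_congr fun θ _ => ?_
    have hne : circleMap 0 R θ ≠ 0 := circleMap_ne_center hR.ne'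
    simp only [pow_succ]
    field_simp
  rw [hI, ← hper] at h
  have hk : (k.factorial : ℂ) ≠ 0 := by exact_mod_cast k.factorial_ne_zero
  have hpi : (Real.pi : ℂ) ≠ 0 := by exact_mod_cast Real.pi_ne_zero
  have h' : (∫ θ in (-Real.pi)..Real.pi,
      (circleMap 0 R θ ^ k)⁻¹ * phase n a (circleMap 0 R θ)) =
      2 * Real.pi / k.factorial * scaledHermite n a k := by
    apply mul_left_cancel₀ Complex.I_ne_zero
    rw [h]; ring
  rw [h']
  field_simp

lemma norm_phase_le (n : ℕ) {a : ℂ} (w : ℂ) :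
    ‖phase n a w‖ ≤ Real.exp (n * (w.re + ‖a‖ / 2 * ‖w - 1‖ ^ 2)) := by
  rw [phase, Complex.norm_exp]
  apply Real.exp_le_exp.2
  have h1 : ((n : ℂ) * (w - a / 2 * (w - 1) ^ 2)).re = n * (w.re - (a / 2 * (w - 1) ^ 2).re) := by
    rw [← Complex.ofReal_natCast, Complex.re_ofReal_mul, Complex.sub_re]
  rw [h1]
  have h2 : -(a / 2 * (w - 1) ^ 2).re ≤ ‖a‖ / 2 * ‖w - 1‖ ^ 2 := by
    have := (neg_le_abs _).trans (Complex.abs_re_le_norm (a / 2 * (w - 1) ^ 2))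
    simpa using this
  have : (0 : ℝ) ≤ n := n.cast_nonneg
  nlinarith

lemma norm_sub_one_sq (w : ℂ) : ‖w - 1‖ ^ 2 = ‖w‖ ^ 2 - 2 * w.re + 1 := by
  rw [← Complex.normSq_eq_norm_sq, ← Complex.normSq_eq_norm_sq, Complex.normSq_apply,
    Complex.normSq_apply]
  simp
  ring

/-- For `‖a‖ ≤ 1` the exponent is at most `Re w + |w - 1|²/2`, which equals `(1 + |w|²)/2` and
depends on the modulus alone. -/
lemma norm_phase_le_of_norm_le_one (n : ℕ) {a : ℂ} (ha : ‖a‖ ≤ 1) (w : ℂ) :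
    ‖phase n a w‖ ≤ Real.exp (n * ((1 + ‖w‖ ^ 2) / 2)) := by
  refine (norm_phase_le n w).trans (Real.exp_le_exp.2 ?_)
  refine mul_le_mul_of_nonneg_left ?_ n.cast_nonneg
  have h := sq_nonneg ‖w - 1‖
  have h2 := norm_sub_one_sq w
  nlinarith

/-- On the unit circle `|w - 1|² = 2(1 - cos θ)`, so the exponent is at most `n(1 - (1 - ‖a‖)(1 -
cos θ))`. The bound `1 - cos θ ≥ 2θ²/π²` then gives Gaussian decay. -/
lemma norm_phase_circle_le (n : ℕ) {a : ℂ} (ha : ‖a‖ ≤ 1) {θ : ℝ} (hθ : |θ| ≤ Real.pi) :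
    ‖phase n a (circleMap 0 1 θ)‖ ≤
      Real.exp n * Real.exp (-(n * (1 - ‖a‖) * (2 / Real.pi ^ 2)) * θ ^ 2) := by
  refine (norm_phase_le n _).trans ?_
  rw [← Real.exp_add, Real.exp_le_exp, norm_sub_one_sq]
  have h1 : (circleMap 0 1 θ).re = Real.cos θ := by
    simp [circleMap, Complex.exp_ofReal_mul_I_re]
  have h2 := Real.cos_le_one_sub_mul_cos_sq hθ
  have h3 : ‖circleMap 0 1 θ‖ = 1 := by simp
  rw [h1, h3]
  have h4 : (n : ℝ) * (1 - ‖a‖) * (2 / Real.pi ^ 2 * θ ^ 2) ≤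
      n * (1 - ‖a‖) * (1 - Real.cos θ) :=
    mul_le_mul_of_nonneg_left (by linarith) (mul_nonneg n.cast_nonneg (by linarith))
  nlinarith

lemma norm_scaledHermite_le (n : ℕ) {a : ℂ} (ha : ‖a‖ ≤ 1) (k : ℕ) {R : ℝ} (hR : 0 < R) :
    ‖scaledHermite n a k‖ ≤ k.factorial * (R ^ k)⁻¹ * Real.exp (n * ((1 + R ^ 2) / 2)) := by
  rw [scaledHermite_eq_integral n a k hR, norm_mul]
  have h1 : ‖(k.factorial / (2 * Real.pi) : ℂ)‖ = k.factorial / (2 * Real.pi) := by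
    simp [abs_of_pos Real.pi_pos]
  have h2 := intervalIntegral.norm_integral_le_of_norm_le_const (a := -Real.pi) (b := Real.pi)
    (f := fun θ => (circleMap 0 R θ ^ k)⁻¹ * phase n a (circleMap 0 R θ))
    (C := (R ^ k)⁻¹ * Real.exp (n * ((1 + R ^ 2) / 2))) (fun θ _ => by
      have hn : ‖circleMap 0 R θ‖ = R := by simp [abs_of_pos hR]
      rw [norm_mul, norm_inv, norm_pow, hn]
      have := norm_phase_le_of_norm_le_one n ha (circleMap 0 R θ)
      rw [hn] at this
      gcongr)
  have h3 : |Real.pi - -Real.pi| = 2 * Real.pi := by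
    rw [abs_of_pos (by linarith [Real.pi_pos])]; ring
  rw [h3] at h2
  rw [h1]
  calc _ ≤ (k.factorial / (2 * Real.pi)) *
        ((R ^ k)⁻¹ * Real.exp (n * ((1 + R ^ 2) / 2)) * (2 * Real.pi)) := by
        gcongr
    _ = _ := by
        have := Real.pi_ne_zero
        field_simp

/-- The unit circle passes through the saddle point, and integrating the Gaussian decay there gains
the factor `1/√n`, at the price of `‖a‖ < 1`. -/
lemma norm_scaledHermite_le_gaussian {n : ℕ} (hn : 0 < n) {a : ℂ} (ha : ‖a‖ < 1) (k : ℕ) :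
    ‖scaledHermite n a k‖ ≤ k.factorial * Real.exp n / √n * √(Real.pi / (8 * (1 - ‖a‖))) := by
  rw [scaledHermite_eq_integral n a k one_pos, norm_mul]
  have hn' : (0 : ℝ) < n := by exact_mod_cast hn
  have ha' : 0 < 1 - ‖a‖ := by linarith
  have h1 : ‖(k.factorial / (2 * Real.pi) : ℂ)‖ = k.factorial / (2 * Real.pi) := by
    simp [abs_of_pos Real.pi_pos]
  set b : ℝ := n * (1 - ‖a‖) * (2 / Real.pi ^ 2) with hb
  have hbpos : 0 < b := by have := Real.pi_pos; positivity
  have hInt := integrable_exp_neg_mul_sq hbpos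
  have hle : -Real.pi ≤ Real.pi := by linarith [Real.pi_pos]
  have h2 : ‖∫ θ in (-Real.pi)..Real.pi,
      (circleMap 0 1 θ ^ k)⁻¹ * phase n a (circleMap 0 1 θ)‖ ≤
      ∫ θ in (-Real.pi)..Real.pi, Real.exp n * Real.exp (-b * θ ^ 2) := by
    refine intervalIntegral.norm_integral_le_of_norm_le hle ?_
      ((hInt.const_mul _).intervalIntegrable)
    refine Filter.Eventually.of_forall fun θ hθ => ?_
    rw [norm_mul, norm_inv, norm_pow]
    have := norm_phase_circle_le n ha.le (abs_le.2 ⟨hθ.1.le, hθ.2⟩)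
    simpa using this
  have h3 : ∫ θ in (-Real.pi)..Real.pi, Real.exp n * Real.exp (-b * θ ^ 2) ≤
      Real.exp n * √(Real.pi / b) := by
    rw [intervalIntegral.integral_const_mul, intervalIntegral.integral_of_le hle,
      ← integral_gaussian]
    exact mul_le_mul_of_nonneg_left (setIntegral_le_integral hInt
      (Filter.Eventually.of_forall fun θ => (Real.exp_pos _).le)) (Real.exp_pos _).le
  have h4 : √(Real.pi / b) = 2 * Real.pi * (√(Real.pi / (8 * (1 - ‖a‖))) / √n) := by
    rw [← Real.sqrt_div' _ hn'.le, ← Real.sqrt_sq (x := 2 * Real.pi) (by positivity),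
      ← Real.sqrt_mul (by positivity), hb]
    congr 1
    have := Real.pi_ne_zero
    field_simp
    norm_num
  rw [h1]
  calc _ ≤ (k.factorial / (2 * Real.pi)) * (Real.exp n * √(Real.pi / b)) := by
        gcongr; exact h2.trans h3
    _ = _ := by
        rw [h4]
        have := Real.pi_ne_zero
        field_simp

end Phase

/-! ### The second moment of the normalised polynomial as a sum over `j = n - k`. -/

section SecondMomentFormula

/-- The summands of the second moment of the normalised characteristic polynomial. -/
def momentTerm (n : ℕ) (a : ℂ) (x : ℝ) (j : ℕ) : ℝ :=
  if j ≤ n then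
    x ^ j * (n.factorial / ((n - j).factorial * (n : ℝ) ^ (n + (n - j)))) *
      ‖scaledHermite n a (n - j)‖ ^ 2
  else 0

lemma momentTerm_nonneg (n : ℕ) (a : ℂ) {x : ℝ} (hx : 0 ≤ x) (j : ℕ) : 0 ≤ momentTerm n a x j := by
  unfold momentTerm
  split_ifs
  · positivity
  · rfl

lemma measurable_normCharPoly (n : ℕ) (t : ℝ) :
    Measurable fun p : Matrix (Fin n) (Fin n) ℂ × ℂ => normCharPoly n t p.1 p.2 := by
  unfold normCharPoly
  simp only [Matrix.det_apply']
  have h : ∀ i j, Measurable fun p : Matrix (Fin n) (Fin n) ℂ × ℂ => p.1 i j := fun i j =>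
    ((measurable_pi_apply (X := fun _ : Fin n => ℂ) j).comp
      (measurable_pi_apply (X := fun _ : Fin n => Fin n → ℂ) i)).comp measurable_fst
  refine Measurable.mul (Finset.measurable_sum _ fun σ _ => Measurable.const_mul
    (Finset.measurable_prod _ fun i _ => ?_) _) (by fun_prop)
  simp only [Matrix.sub_apply, Matrix.smul_apply, smul_eq_mul]
  exact Measurable.sub (by fun_prop) (Measurable.mul (by fun_prop) (h _ _))

lemma measurable_normCharPoly_left (n : ℕ) (t : ℝ) (z : ℂ) :
    Measurable fun A : Matrix (Fin n) (Fin n) ℂ => normCharPoly n t A z := by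
  have h : Measurable fun A : Matrix (Fin n) (Fin n) ℂ => (A, z) := measurable_prodMk_right
  have e : (fun A : Matrix (Fin n) (Fin n) ℂ => normCharPoly n t A z) =
      (fun p : Matrix (Fin n) (Fin n) ℂ × ℂ => normCharPoly n t p.1 p.2) ∘ (fun A => (A, z)) := rfl
  rw [e]
  exact (measurable_normCharPoly n t).comp h

lemma integrable_normSq_normCharPoly (n : ℕ) (t : ℝ) (z : ℂ) :
    Integrable (fun A => ‖normCharPoly n t A z‖ ^ 2) (egeLaw n t) := by
  rw [egeLaw_eq_map, integrable_map_measure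
    ((measurable_normCharPoly_left n t z).norm.pow_const 2).aestronglyMeasurable
    (measurable_egeMatrix n t).aemeasurable]
  have h := ((allMoments_det (n := n) (t := t) (1 + (t : ℂ) * z ^ 2)
    (z / ((√(n : ℝ) : ℝ) : ℂ))).const_mul
      (Complex.exp (-((n : ℂ) * (t : ℂ) * z ^ 2) / 2))) 2
  refine ((memLp_two_iff_integrable_sq_norm h.1).1 (by exact_mod_cast h)).congr
    (Eventually.of_forall fun ω => ?_)
  simp only [Function.comp, normCharPoly]
  rw [mul_comm]

lemma integral_normSq_det {n : ℕ} {t : ℝ} (h0 : -1 ≤ t) (h1 : t ≤ 1) (u : ℂ) :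
    ∫ ω, ‖(u • (1 : Matrix (Fin n) (Fin n) ℂ) - egeMatrix n t ω).det‖ ^ 2
        ∂((gaussianArray n).prod (gaussianArray n)) =
      ∑ k ∈ Finset.range (n + 1), (n.factorial / k.factorial : ℝ) *
        ‖hermiteVar (t : ℂ) u k‖ ^ 2 := by
  apply Complex.ofReal_injective
  rw [← integral_complex_ofReal]
  have e : ∀ w : ℂ, ((‖w‖ ^ 2 : ℝ) : ℂ) = w * (starRingEnd ℂ) w := fun w => by
    rw [Complex.mul_conj, Complex.normSq_eq_norm_sq]
  simp only [e, integral_normSq_charpoly h0 h1 u]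
  rw [hermiteSum, Complex.ofReal_sum]
  refine Finset.sum_congr rfl fun k hk => ?_
  rw [Complex.ofReal_mul, e, map_hermiteVar, Complex.conj_ofReal]
  congr 1
  have hk' : k ≤ n := by simpa [Nat.lt_succ_iff] using hk
  have h2 := Nat.choose_mul_factorial_mul_factorial hk'
  have h3 : (k.factorial : ℂ) ≠ 0 := by exact_mod_cast k.factorial_ne_zero
  push_cast
  rw [eq_div_iff h3, ← h2]
  push_cast
  ring

/-- The second moment of the normalised characteristic polynomial. -/
theorem integral_normSq_normCharPoly {n : ℕ} (hn : 0 < n) {t : ℝ} (h0 : -1 ≤ t) (h1 : t ≤ 1)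
    {z : ℂ} (hz : z ≠ 0) :
    ∫ A, ‖normCharPoly n t A z‖ ^ 2 ∂(egeLaw n t) =
      ∑ j ∈ Finset.range (n + 1), momentTerm n (t * z ^ 2) (‖z‖ ^ 2) j := by
  rw [egeLaw_eq_map, integral_map (measurable_egeMatrix n t).aemeasurable
    ((measurable_normCharPoly_left n t z).norm.pow_const 2).aestronglyMeasurable]
  have hn' : (0 : ℝ) < n := by exact_mod_cast hn
  set a : ℂ := t * z ^ 2 with ha
  set s : ℂ := ((√(n : ℝ) : ℝ) : ℂ) with hs
  have hs2 : s ^ 2 = n := by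
    rw [hs, ← Complex.ofReal_pow, Real.sq_sqrt hn'.le, Complex.ofReal_natCast]
  have hs0 : s ≠ 0 := by rw [hs]; exact_mod_cast (Real.sqrt_pos.2 hn').ne'
  have hsn : ‖s‖ ^ 2 = n := by rw [← norm_pow, hs2]; simp
  set ζ : ℂ := (1 + a) * s / z with hζ
  set E : ℂ := Complex.exp (-(n * a) / 2) with hE
  -- Pulling `z/√n` out of each row reduces to the characteristic polynomial at `ζ`. This is where
  -- `z ≠ 0` enters.
  have hpt : ∀ ω, ‖normCharPoly n t (egeMatrix n t ω) z‖ ^ 2 =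
      ((‖z‖ ^ 2 / n) ^ n * ‖E‖ ^ 2) *
        ‖(ζ • (1 : Matrix (Fin n) (Fin n) ℂ) - egeMatrix n t ω).det‖ ^ 2 := by
    intro ω
    have e1 : (1 + a) • (1 : Matrix (Fin n) (Fin n) ℂ) - (z / s) • egeMatrix n t ω =
        (z / s) • (ζ • (1 : Matrix (Fin n) (Fin n) ℂ) - egeMatrix n t ω) := by
      rw [smul_sub, smul_smul]
      congr 2
      rw [hζ]; field_simp
    have e2 : normCharPoly n t (egeMatrix n t ω) z = ((z / s) ^ n *
        (ζ • (1 : Matrix (Fin n) (Fin n) ℂ) - egeMatrix n t ω).det) * E := by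
      rw [normCharPoly, ← ha, ← hs, e1, Matrix.det_smul, Fintype.card_fin, hE, ha,
        mul_assoc (n : ℂ)]
    rw [e2, norm_mul, norm_mul, norm_pow, norm_div, mul_pow, mul_pow, ← pow_mul, mul_comm n 2,
      pow_mul, div_pow, hsn]
    ring
  simp only [hpt]
  rw [integral_const_mul, integral_normSq_det h0 h1, Finset.mul_sum,
    ← Finset.sum_range_reflect (fun j => momentTerm n a (‖z‖ ^ 2) j)]
  refine Finset.sum_congr rfl fun k hk => ?_
  have hk' : k ≤ n := by simpa [Nat.lt_succ_iff] using hk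
  have hx : 0 < ‖z‖ ^ 2 := by positivity
  -- Multiplying by `√n z` turns the variance `t` into `na` and the argument `ζ` into `n(1 + a)`,
  -- the parameters of `scaledHermite`.
  have hsc := hermiteVar_scale (s * z) (t : ℂ) ζ k
  rw [show (s * z) ^ 2 * (t : ℂ) = n * a by rw [mul_pow, hs2, ha]; ring,
    show s * z * ζ = n * (1 + a) by rw [hζ, ← hs2]; field_simp] at hsc
  have hH : ‖scaledHermite n a k‖ ^ 2 =
      (n * ‖z‖ ^ 2) ^ k * ‖hermiteVar (t : ℂ) ζ k‖ ^ 2 * ‖E‖ ^ 2 := by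
    rw [scaledHermite, hsc, norm_mul, norm_mul, norm_pow, norm_mul, mul_pow, mul_pow, ← pow_mul,
      mul_comm k 2, pow_mul, mul_pow, hsn]
  rw [momentTerm, if_pos (by omega), show n + 1 - 1 - k = n - k by omega,
    show n - (n - k) = k by omega, hH]
  have hxn : (‖z‖ ^ 2) ^ n = (‖z‖ ^ 2) ^ (n - k) * (‖z‖ ^ 2) ^ k := by
    rw [← pow_add, Nat.sub_add_cancel hk']
  rw [div_pow, hxn, pow_add, mul_pow]
  have : (k.factorial : ℝ) ≠ 0 := by exact_mod_cast k.factorial_ne_zero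
  field_simp

end SecondMomentFormula

/-! ### A summable majorant for the terms of the second moment. -/

section Bounds

/-- Stirling's sequence decreases from its value `e/√2` at `m = 1`. -/
lemma factorial_mul_exp_le {m : ℕ} (hm : 0 < m) :
    (m.factorial : ℝ) * Real.exp m ≤ Real.exp 1 * √m * (m : ℝ) ^ m := by
  obtain ⟨k, rfl⟩ := Nat.exists_eq_succ_of_ne_zero hm.ne'
  have h := Stirling.stirlingSeq'_antitone (Nat.zero_le k)
  simp only [Function.comp, Nat.succ_eq_add_one, zero_add, Stirling.stirlingSeq_one] at h
  rw [Stirling.stirlingSeq] at h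
  have hp : (0 : ℝ) < ((k + 1 : ℕ) : ℝ) := by positivity
  rw [div_le_iff₀ (by positivity), Real.sqrt_mul (by norm_num), div_pow, ← Real.exp_nat_mul,
    mul_one] at h
  simp only [Nat.succ_eq_add_one]
  have h2 : (0 : ℝ) < √2 := by positivity
  calc _ ≤ Real.exp 1 / √2 * (√2 * √((k + 1 : ℕ) : ℝ) *
        (((k + 1 : ℕ) : ℝ) ^ (k + 1) / Real.exp ((k + 1 : ℕ) : ℝ))) * Real.exp ((k + 1 : ℕ) : ℝ) := by
        gcongr
    _ = _ := by field_simp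

lemma momentTerm_le_linear {n : ℕ} (hn : 0 < n) {a : ℂ} (ha : ‖a‖ ≤ 1) {x : ℝ} (hx : 0 ≤ x)
    (j : ℕ) : momentTerm n a x j ≤ 2 * Real.exp 1 ^ 2 * n * x ^ j := by
  have hn' : (1 : ℝ) ≤ n := by exact_mod_cast hn
  unfold momentTerm
  split_ifs with hj
  swap
  · positivity
  set k := n - j with hk
  have hkn : (k : ℝ) ≤ n := by exact_mod_cast Nat.sub_le n j
  -- Minimising `R^{-k} exp(nR²/2)` gives `R² = k/n`. Using `k + 1` instead keeps the radius
  -- positive when `k = 0` and costs only a constant after Stirling.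
  set R : ℝ := √(((k + 1 : ℕ) : ℝ) / n) with hR
  have hRsq : R ^ 2 = ((k + 1 : ℕ) : ℝ) / n := Real.sq_sqrt (by positivity)
  have hRpos : 0 < R := Real.sqrt_pos.2 (by positivity)
  have hH := norm_scaledHermite_le n ha k hRpos
  have hH2 : ‖scaledHermite n a k‖ ^ 2 ≤ (k.factorial : ℝ) ^ 2 *
      ((n : ℝ) ^ k / ((k + 1 : ℕ) : ℝ) ^ k) * (Real.exp n * Real.exp ((k + 1 : ℕ) : ℝ)) := by
    calc _ ≤ (k.factorial * (R ^ k)⁻¹ * Real.exp (n * ((1 + R ^ 2) / 2))) ^ 2 := by gcongr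
      _ = (k.factorial : ℝ) ^ 2 * ((R ^ 2) ^ k)⁻¹ * Real.exp (n * ((1 + R ^ 2) / 2)) ^ 2 := by ring
      _ = _ := by
        rw [hRsq, ← div_pow, ← inv_pow, inv_div, ← Real.exp_add, ← Real.exp_nat_mul]
        congr 2
        push_cast
        field_simp
  have s1 := factorial_mul_exp_le hn
  have s2 := factorial_mul_exp_le (Nat.succ_pos k)
  simp only [Nat.succ_eq_add_one] at s2
  have hq : √(n : ℝ) * √((k + 1 : ℕ) : ℝ) ≤ 2 * n := by
    rw [← Real.sqrt_mul (by positivity)]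
    apply Real.sqrt_le_iff.2
    push_cast
    constructor
    · positivity
    · nlinarith
  calc _ ≤ x ^ j * (n.factorial / (k.factorial * (n : ℝ) ^ (n + k))) * ((k.factorial : ℝ) ^ 2 *
      ((n : ℝ) ^ k / ((k + 1 : ℕ) : ℝ) ^ k) * (Real.exp n * Real.exp ((k + 1 : ℕ) : ℝ))) := by
        gcongr
    _ = x ^ j * ((n.factorial * Real.exp n) * ((k + 1).factorial * Real.exp ((k + 1 : ℕ) : ℝ)) /
        ((n : ℝ) ^ n * ((k + 1 : ℕ) : ℝ) ^ (k + 1))) := by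
        rw [Nat.factorial_succ, pow_add, pow_succ ((k + 1 : ℕ) : ℝ)]
        have : (k.factorial : ℝ) ≠ 0 := by exact_mod_cast k.factorial_ne_zero
        push_cast
        field_simp
    _ ≤ x ^ j * ((Real.exp 1 * √n * (n : ℝ) ^ n) *
        (Real.exp 1 * √((k + 1 : ℕ) : ℝ) * ((k + 1 : ℕ) : ℝ) ^ (k + 1)) /
        ((n : ℝ) ^ n * ((k + 1 : ℕ) : ℝ) ^ (k + 1))) := by gcongr
    _ = x ^ j * (Real.exp 1 ^ 2 * (√n * √((k + 1 : ℕ) : ℝ))) := by field_simp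
    _ ≤ x ^ j * (Real.exp 1 ^ 2 * (2 * n)) := by gcongr
    _ = _ := by ring

lemma momentTerm_le_geometric {n : ℕ} (hn : 0 < n) {a : ℂ} (ha : ‖a‖ < 1) {x q : ℝ} (hx : 0 ≤ x)
    (hq : 0 < q) {j : ℕ} (hj : j ≤ n) (hqn : q * n ≤ (n - j : ℕ)) :
    momentTerm n a x j ≤ Real.pi / (8 * (1 - ‖a‖)) * Real.exp 1 ^ 2 * (x / q) ^ j := by
  have hn' : (0 : ℝ) < n := by exact_mod_cast hn
  have ha' : 0 < 1 - ‖a‖ := by linarith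
  rw [momentTerm, if_pos hj]
  set k := n - j with hk
  set C := Real.pi / (8 * (1 - ‖a‖)) with hC
  have hCpos : 0 ≤ C := by have := Real.pi_pos; positivity
  have hH2 : ‖scaledHermite n a k‖ ^ 2 ≤ (k.factorial * Real.exp n) ^ 2 / n * C := by
    calc _ ≤ (k.factorial * Real.exp n / √n * √C) ^ 2 := by
          gcongr
          exact norm_scaledHermite_le_gaussian hn ha k
      _ = _ := by rw [mul_pow, Real.sq_sqrt hCpos, div_pow, Real.sq_sqrt hn'.le]
  have s1 := factorial_mul_exp_le hn
  -- Each of the `j` factors of `n!/k!` is at least `k + 1`, hence at least `qn`.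
  have hf : (k.factorial : ℝ) * (q * n) ^ j ≤ n.factorial := by
    calc (k.factorial : ℝ) * (q * n) ^ j ≤ k.factorial * ((k + 1 : ℕ) : ℝ) ^ j := by
          gcongr
          refine hqn.trans ?_
          push_cast
          linarith
      _ ≤ ((k + j).factorial : ℕ) := by exact_mod_cast Nat.factorial_mul_pow_le_factorial
      _ = _ := by rw [hk, Nat.sub_add_cancel hj]
  have hnk : (n : ℝ) ^ n = n ^ k * n ^ j := by rw [← pow_add, hk, Nat.sub_add_cancel hj]
  have hk0 : (k.factorial : ℝ) ≠ 0 := by exact_mod_cast k.factorial_ne_zero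
  calc _ ≤ x ^ j * (n.factorial / (k.factorial * (n : ℝ) ^ (n + k))) *
        ((k.factorial * Real.exp n) ^ 2 / n * C) := by gcongr
    _ = C * x ^ j * (k.factorial / n.factorial) *
        ((n.factorial * Real.exp n) ^ 2 / (n * n ^ n * n ^ k)) := by
        rw [pow_add]
        have : (n.factorial : ℝ) ≠ 0 := by exact_mod_cast n.factorial_ne_zero
        field_simp
    _ ≤ C * x ^ j * (1 / (q * n) ^ j) *
        ((Real.exp 1 * √n * (n : ℝ) ^ n) ^ 2 / (n * n ^ n * n ^ k)) := by
        gcongr ?_ * ?_ * ?_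
        · rw [div_le_div_iff₀ (by positivity) (by positivity), one_mul]
          exact hf
        · gcongr
    _ = C * x ^ j * (1 / (q * n) ^ j) * (Real.exp 1 ^ 2 * n ^ j) := by
        congr 1
        rw [mul_pow, mul_pow, Real.sq_sqrt hn'.le, hnk]
        field_simp
    _ = _ := by
        rw [div_pow, mul_pow]
        field_simp

/-- A summable majorant of the second moment summands, uniform on discs. -/
def momentBound (x₁ : ℝ) (j : ℕ) : ℝ :=
  Real.pi / (8 * (1 - x₁)) * Real.exp 1 ^ 2 * √x₁ ^ j +
    2 * Real.exp 1 ^ 2 / (1 - √x₁) * (j * x₁ ^ j)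

lemma sqrt_lt_one {x : ℝ} (h : x < 1) : √x < 1 := by
  rw [Real.sqrt_lt' one_pos]; simpa using h

lemma summable_momentBound {x₁ : ℝ} (h0 : 0 ≤ x₁) (h1 : x₁ < 1) : Summable (momentBound x₁) := by
  refine Summable.add (Summable.mul_left _ (summable_geometric_of_lt_one (Real.sqrt_nonneg _)
    (sqrt_lt_one h1))) (Summable.mul_left _ ?_)
  have := summable_pow_mul_geometric_of_norm_lt_one (R := ℝ) 1
    (r := x₁) (by rwa [Real.norm_of_nonneg h0])
  simpa using this

lemma momentTerm_le_momentBound {n : ℕ} (hn : 0 < n) {a : ℂ} {x x₁ : ℝ} (hx : 0 ≤ x)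
    (hx₁ : x ≤ x₁) (h0 : 0 < x₁) (h1 : x₁ < 1) (ha : ‖a‖ ≤ x₁) (j : ℕ) :
    momentTerm n a x j ≤ momentBound x₁ j := by
  have hs0 : 0 < √x₁ := Real.sqrt_pos.2 h0
  have hs1 : 0 < 1 - √x₁ := by linarith [sqrt_lt_one h1]
  have hpi := Real.pi_pos
  have hx1' : 0 < 1 - x₁ := by linarith
  have hA : 0 ≤ Real.pi / (8 * (1 - x₁)) * Real.exp 1 ^ 2 * √x₁ ^ j := by positivity
  have hB : 0 ≤ 2 * Real.exp 1 ^ 2 / (1 - √x₁) * (j * x₁ ^ j) := by positivity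
  unfold momentBound
  by_cases hj : j ≤ n
  swap
  · rw [momentTerm, if_neg hj]; positivity
  -- The threshold `q = √x₁` makes the geometric ratio `x/q` at most `√x₁ < 1`. Beyond it, `n` is at
  -- most `j/(1 - √x₁)`, so the linear factor `n` becomes a factor `j`, still summable against
  -- `x₁^j`.
  by_cases hk : √x₁ * n ≤ (n - j : ℕ)
  · refine le_add_of_le_of_nonneg ((momentTerm_le_geometric hn (by linarith) hx hs0 hj hk).trans ?_) hB
    have : x / √x₁ ≤ √x₁ := by
      rw [div_le_iff₀ hs0, Real.mul_self_sqrt h0.le]; exact hx₁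
    gcongr
  · refine le_add_of_nonneg_of_le hA ((momentTerm_le_linear hn (by linarith) hx j).trans ?_)
    rw [Nat.cast_sub hj] at hk
    have hnj : (n : ℝ) ≤ j / (1 - √x₁) := by
      rw [le_div_iff₀ hs1]; nlinarith
    calc 2 * Real.exp 1 ^ 2 * n * x ^ j ≤ 2 * Real.exp 1 ^ 2 * (j / (1 - √x₁)) * x₁ ^ j := by gcongr
      _ = _ := by ring

end Bounds

/-! ### The saddle-point limit and locally uniform convergence. -/

section Limit

open Complex (I)

lemma tendsto_inv_sqrt_natCast : Tendsto (fun n : ℕ => (√(n : ℝ))⁻¹) atTop (𝓝 0) :=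
  tendsto_inv_atTop_zero.comp (Real.tendsto_sqrt_atTop.comp tendsto_natCast_atTop_atTop)

lemma tendsto_mul_exp_sub_one_sub (s : ℝ) :
    Tendsto (fun n : ℕ => (n : ℂ) * (Complex.exp ((s / √(n : ℝ) : ℝ) * I) - 1 -
      (s / √(n : ℝ) : ℝ) * I)) atTop (𝓝 (-(s : ℂ) ^ 2 / 2)) := by
  rw [tendsto_iff_norm_sub_tendsto_zero]
  have hlim : Tendsto (fun n : ℕ => |s| ^ 3 * (√(n : ℝ))⁻¹ * Real.exp (|s| * (√(n : ℝ))⁻¹))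
      atTop (𝓝 0) := by
    have h := ((tendsto_inv_sqrt_natCast.const_mul (|s| ^ 3)).mul
      (Real.continuous_exp.continuousAt.tendsto.comp (tendsto_inv_sqrt_natCast.const_mul |s|)))
    simpa using h
  refine squeeze_zero' (Eventually.of_forall fun n => norm_nonneg _) ?_ hlim
  filter_upwards [eventually_gt_atTop 0] with n hn
  have hn' : (0 : ℝ) < n := by exact_mod_cast hn
  set y : ℂ := (s / √(n : ℝ) : ℝ) * I with hy
  have hyn : ‖y‖ = |s| * (√(n : ℝ))⁻¹ := by
    rw [hy, norm_mul, Complex.norm_I, mul_one, Complex.norm_real, Real.norm_eq_abs, abs_div,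
      abs_of_nonneg (Real.sqrt_nonneg _), div_eq_mul_inv]
  have hy2 : (n : ℂ) * y ^ 2 = -(s : ℂ) ^ 2 := by
    rw [hy, mul_pow, Complex.I_sq, ← Complex.ofReal_pow, div_pow, Real.sq_sqrt hn'.le]
    push_cast
    have : (n : ℂ) ≠ 0 := by exact_mod_cast hn.ne'
    field_simp
  have hb := Complex.norm_exp_sub_sum_le_norm_mul_exp y 3
  have e : (n : ℂ) * (Complex.exp y - 1 - y) - -(s : ℂ) ^ 2 / 2 =
      n * (Complex.exp y - ∑ m ∈ Finset.range 3, y ^ m / (m.factorial : ℂ)) := by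
    rw [← hy2]
    simp [Finset.sum_range_succ, Nat.factorial]
    ring
  rw [e, norm_mul, Complex.norm_natCast]
  calc _ ≤ (n : ℝ) * (‖y‖ ^ 3 * Real.exp ‖y‖) := by gcongr
    _ = _ := by
      rw [hyn, ← mul_assoc]
      congr 1
      have hs : (n : ℝ) = √(n : ℝ) ^ 2 := (Real.sq_sqrt hn'.le).symm
      have hs0 : √(n : ℝ) ≠ 0 := (Real.sqrt_pos.2 hn').ne'
      rw [mul_pow]
      nth_rewrite 1 [hs]
      field_simp

lemma tendsto_mul_exp_sub_one_sq (s : ℝ) :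
    Tendsto (fun n : ℕ => (n : ℂ) * (Complex.exp ((s / √(n : ℝ) : ℝ) * I) - 1) ^ 2)
      atTop (𝓝 (-(s : ℂ) ^ 2)) := by
  have h0 : Tendsto (fun n : ℕ => (((√(n : ℝ))⁻¹ : ℝ) : ℂ)) atTop (𝓝 0) := by
    have := Complex.continuous_ofReal.continuousAt.tendsto.comp tendsto_inv_sqrt_natCast
    simpa [Function.comp_def] using this
  have h1 := (((tendsto_mul_exp_sub_one_sub s).mul h0).add_const ((s : ℂ) * I)).pow 2
  have e : (-(s : ℂ) ^ 2 / 2 * 0 + s * I) ^ 2 = -(s : ℂ) ^ 2 := by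
    rw [mul_zero, zero_add, mul_pow, Complex.I_sq]; ring
  rw [e] at h1
  refine h1.congr' ?_
  filter_upwards [eventually_gt_atTop 0] with n hn
  have hn' : (0 : ℝ) < n := by exact_mod_cast hn
  have hs : (n : ℂ) = ((√(n : ℝ) : ℝ) : ℂ) ^ 2 := by
    rw [← Complex.ofReal_pow, Real.sq_sqrt hn'.le, Complex.ofReal_natCast]
  have hs0 : ((√(n : ℝ) : ℝ) : ℂ) ≠ 0 := by exact_mod_cast (Real.sqrt_pos.2 hn').ne'
  rw [hs]
  push_cast
  field_simp
  ring

/-- The integrand of the rescaled contour integral for the coefficient of index `n - j`. -/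
def saddleKernel (n : ℕ) (a : ℂ) (j : ℕ) : ℝ → ℂ :=
  (Set.Ioc (-Real.pi * √(n : ℝ)) (Real.pi * √(n : ℝ))).indicator fun s =>
    Complex.exp (-n) * ((circleMap 0 1 (s / √(n : ℝ)) ^ (n - j))⁻¹ *
      phase n a (circleMap 0 1 (s / √(n : ℝ))))

lemma measurable_saddleKernel (n : ℕ) (a : ℂ) (j : ℕ) : Measurable (saddleKernel n a j) := by
  refine Measurable.indicator ?_ measurableSet_Ioc
  have h1 : Measurable fun s : ℝ => circleMap 0 1 (s / √(n : ℝ)) :=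
    (continuous_circleMap 0 1).measurable.comp (measurable_id.div_const _)
  exact ((h1.pow_const _).inv.mul
    ((differentiable_phase n a).continuous.measurable.comp h1)).const_mul _

lemma integral_saddleKernel {n : ℕ} (hn : 0 < n) (a : ℂ) (j : ℕ) :
    ((√(n : ℝ) : ℝ) : ℂ) * Complex.exp (-n) * scaledHermite n a (n - j) / (n - j).factorial =
      (2 * Real.pi : ℂ)⁻¹ * ∫ s, saddleKernel n a j s := by
  have hn' : (0 : ℝ) < √(n : ℝ) := Real.sqrt_pos.2 (by exact_mod_cast hn)
  have hle : -Real.pi * √(n : ℝ) ≤ Real.pi * √(n : ℝ) := by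
    have := Real.pi_pos
    nlinarith
  unfold saddleKernel
  rw [integral_indicator measurableSet_Ioc, ← intervalIntegral.integral_of_le hle,
    intervalIntegral.integral_const_mul, intervalIntegral.integral_comp_div
      (fun θ => (circleMap 0 1 θ ^ (n - j))⁻¹ * phase n a (circleMap 0 1 θ)) hn'.ne',
    mul_div_cancel_right₀ _ hn'.ne', mul_div_cancel_right₀ _ hn'.ne',
    scaledHermite_eq_integral n a (n - j) one_pos, Complex.real_smul]
  have hk : ((n - j).factorial : ℂ) ≠ 0 := by exact_mod_cast (n - j).factorial_ne_zero
  field_simp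

lemma norm_saddleKernel_le {n : ℕ} (hn : 0 < n) {a : ℂ} {x₁ : ℝ} (h1 : x₁ < 1) (ha : ‖a‖ ≤ x₁)
    (j : ℕ) (s : ℝ) :
    ‖saddleKernel n a j s‖ ≤ Real.exp (-((1 - x₁) * (2 / Real.pi ^ 2)) * s ^ 2) := by
  have hn0 : (0 : ℝ) < n := by exact_mod_cast hn
  have hn' : (0 : ℝ) < √(n : ℝ) := Real.sqrt_pos.2 hn0
  unfold saddleKernel
  by_cases hs : s ∈ Set.Ioc (-Real.pi * √(n : ℝ)) (Real.pi * √(n : ℝ))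
  swap
  · rw [Set.indicator_of_notMem hs, norm_zero]; positivity
  rw [Set.indicator_of_mem hs]
  have hθ : |s / √(n : ℝ)| ≤ Real.pi := by
    rw [abs_le]
    constructor
    · rw [le_div_iff₀ hn']; exact hs.1.le
    · rw [div_le_iff₀ hn']; exact hs.2
  have h := norm_phase_circle_le n (ha.trans h1.le) hθ
  rw [norm_mul, norm_mul, norm_inv, norm_pow, norm_circleMap_zero, abs_one, one_pow, inv_one,
    one_mul, Complex.norm_exp]
  have e : Real.exp ((-(n : ℂ)).re) = (Real.exp n)⁻¹ := by
    rw [← Real.exp_neg]; simp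
  rw [e, inv_mul_le_iff₀ (Real.exp_pos _)]
  refine h.trans (mul_le_mul_of_nonneg_left (Real.exp_le_exp.2 ?_) (Real.exp_pos _).le)
  rw [div_pow, Real.sq_sqrt hn0.le]
  have e2 : -(n * (1 - ‖a‖) * (2 / Real.pi ^ 2)) * (s ^ 2 / n) =
      -((1 - ‖a‖) * (2 / Real.pi ^ 2)) * s ^ 2 := by field_simp
  rw [e2, neg_mul, neg_mul, neg_le_neg_iff]
  gcongr

/-- With `θ = s/√n`, the exponent is `n(e^{iθ} - 1 - iθ) - (a/2) n(e^{iθ} - 1)² + ijθ`, and its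
three parts tend to `-s²/2`, `a₀ s²/2` and `0`. The joint filter in `n` and `a` is what later gives
uniformity. -/
lemma tendsto_saddleKernel (a₀ : ℂ) (j : ℕ) (s : ℝ) :
    Tendsto (fun p : ℕ × ℂ => saddleKernel p.1 p.2 j s) (atTop ×ˢ 𝓝 a₀)
      (𝓝 (Complex.exp (-((1 - a₀) / 2) * (s : ℂ) ^ 2))) := by
  have hθ : Tendsto (fun n : ℕ => ((s / √(n : ℝ) : ℝ) : ℂ)) atTop (𝓝 0) := by
    have := Complex.continuous_ofReal.continuousAt.tendsto.comp
      (tendsto_inv_sqrt_natCast.const_mul s)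
    simpa [Function.comp_def, div_eq_mul_inv] using this
  have hexp : Tendsto (fun p : ℕ × ℂ =>
      (p.1 : ℂ) * (Complex.exp ((s / √(p.1 : ℝ) : ℝ) * I) - 1 - (s / √(p.1 : ℝ) : ℝ) * I) -
      p.2 / 2 * ((p.1 : ℂ) * (Complex.exp ((s / √(p.1 : ℝ) : ℝ) * I) - 1) ^ 2) +
      ((s / √(p.1 : ℝ) : ℝ) : ℂ) * (j * I)) (atTop ×ˢ 𝓝 a₀)
      (𝓝 (-(s : ℂ) ^ 2 / 2 - a₀ / 2 * -(s : ℂ) ^ 2 + 0 * (j * I))) :=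
    (((tendsto_mul_exp_sub_one_sub s).comp tendsto_fst).sub ((tendsto_snd.div_const 2).mul
      ((tendsto_mul_exp_sub_one_sq s).comp tendsto_fst))).add
      ((hθ.comp tendsto_fst).mul_const _)
  have h := Complex.continuous_exp.continuousAt.tendsto.comp hexp
  rw [show -(s : ℂ) ^ 2 / 2 - a₀ / 2 * -(s : ℂ) ^ 2 + 0 * (j * I) =
    -((1 - a₀) / 2) * (s : ℂ) ^ 2 by ring] at h
  refine h.congr' ?_
  have hbig : ∀ᶠ n : ℕ in atTop, |s| < Real.pi * √(n : ℝ) :=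
    ((Real.tendsto_sqrt_atTop.comp tendsto_natCast_atTop_atTop).const_mul_atTop
      Real.pi_pos).eventually_gt_atTop |s|
  -- For large `n` the point `s` lies inside the truncation interval and the subtraction `n - j` is
  -- not truncated.
  filter_upwards [tendsto_fst.eventually (hbig.and (eventually_ge_atTop j))] with p hp
  obtain ⟨hs, hj⟩ := hp
  have hs' := abs_lt.1 hs
  have hmem : s ∈ Set.Ioc (-Real.pi * √(p.1 : ℝ)) (Real.pi * √(p.1 : ℝ)) :=
    ⟨by linarith, hs'.2.le⟩
  rw [saddleKernel, Set.indicator_of_mem hmem]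
  have hw : circleMap 0 1 (s / √(p.1 : ℝ)) = Complex.exp ((s / √(p.1 : ℝ) : ℝ) * I) := by
    simp [circleMap]
  rw [hw, phase, ← Complex.exp_nat_mul, ← Complex.exp_neg, ← Complex.exp_add, ← Complex.exp_add,
    Nat.cast_sub hj]
  simp only [Function.comp]
  congr 1
  ring

lemma tendsto_scaledHermite {a₀ : ℂ} (ha₀ : ‖a₀‖ < 1) (j : ℕ) :
    Tendsto (fun p : ℕ × ℂ => ((√(p.1 : ℝ) : ℝ) : ℂ) * Complex.exp (-p.1) *
      scaledHermite p.1 p.2 (p.1 - j) / (p.1 - j).factorial) (atTop ×ˢ 𝓝 a₀)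
      (𝓝 ((2 * Real.pi : ℂ)⁻¹ * (Real.pi / ((1 - a₀) / 2)) ^ (1 / 2 : ℂ))) := by
  obtain ⟨x₁, hx₁, h1⟩ := exists_between ha₀
  have hre : 0 < ((1 - a₀) / 2).re := by
    have := (le_abs_self _).trans (Complex.abs_re_le_norm a₀)
    simp
    linarith
  have hb : 0 < (1 - x₁) * (2 / Real.pi ^ 2) := by
    have := Real.pi_pos
    have : 0 < 1 - x₁ := by linarith
    positivity
  have hn : ∀ᶠ p : ℕ × ℂ in atTop ×ˢ 𝓝 a₀, 0 < p.1 :=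
    tendsto_fst.eventually (eventually_gt_atTop 0)
  have ha : ∀ᶠ p : ℕ × ℂ in atTop ×ˢ 𝓝 a₀, ‖p.2‖ ≤ x₁ :=
    tendsto_snd.eventually ((continuous_norm.tendsto a₀).eventually (eventually_le_nhds hx₁))
  have h := tendsto_integral_filter_of_dominated_convergence (μ := volume)
    (l := (atTop : Filter ℕ) ×ˢ 𝓝 a₀)
    (F := fun p : ℕ × ℂ => saddleKernel p.1 p.2 j)
    (fun s => Real.exp (-((1 - x₁) * (2 / Real.pi ^ 2)) * s ^ 2))
    (Eventually.of_forall fun p => (measurable_saddleKernel p.1 p.2 j).aestronglyMeasurable)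
    (by filter_upwards [hn, ha] with p hp hp' using
      Eventually.of_forall fun s => norm_saddleKernel_le hp h1 hp' j s)
    (integrable_exp_neg_mul_sq hb)
    (Eventually.of_forall fun s => tendsto_saddleKernel a₀ j s)
  rw [integral_gaussian_complex hre] at h
  refine (h.const_mul (2 * Real.pi : ℂ)⁻¹).congr' ?_
  filter_upwards [hn] with p hp
  exact (integral_saddleKernel hp p.2 j).symm

/-- The inverse is the falling factorial divided by `n^j`, a product of `j` factors each tending to
1. -/
lemma tendsto_factorial_ratio (j : ℕ) :
    Tendsto (fun n : ℕ => ((n - j).factorial : ℝ) * (n : ℝ) ^ j / n.factorial) atTop (𝓝 1) := by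
  have h : Tendsto (fun n : ℕ => ((n.descFactorial j : ℕ) : ℝ) / (n : ℝ) ^ j) atTop (𝓝 1) := by
    refine (Asymptotics.isEquivalent_iff_tendsto_one ?_).1 (isEquivalent_descFactorial j)
    filter_upwards [eventually_gt_atTop 0] with n hn
    have : (n : ℝ) ≠ 0 := by exact_mod_cast hn.ne'
    positivity
  have h' := h.inv₀ one_ne_zero
  rw [inv_one] at h'
  refine h'.congr' ?_
  filter_upwards [eventually_ge_atTop j] with n hn
  rw [inv_div, ← Nat.factorial_mul_descFactorial hn]
  have h1 : ((n - j).factorial : ℝ) ≠ 0 := by exact_mod_cast (n - j).factorial_ne_zero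
  push_cast
  rw [mul_div_mul_left _ _ h1]

lemma tendsto_momentTerm {t : ℝ} {z₀ : ℂ} (ha₀ : ‖(t : ℂ) * z₀ ^ 2‖ < 1) (j : ℕ) :
    Tendsto (fun p : ℕ × ℂ => momentTerm p.1 (t * p.2 ^ 2) (‖p.2‖ ^ 2) j) (atTop ×ˢ 𝓝 z₀)
      (𝓝 ((‖z₀‖ ^ 2) ^ j * ‖1 - (t : ℂ) * z₀ ^ 2‖⁻¹)) := by
  set a₀ : ℂ := t * z₀ ^ 2 with ha
  have hmap : Tendsto (fun p : ℕ × ℂ => (p.1, (t : ℂ) * p.2 ^ 2)) (atTop ×ˢ 𝓝 z₀)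
      (atTop ×ˢ 𝓝 a₀) :=
    tendsto_fst.prodMk (((tendsto_id.pow 2).const_mul (t : ℂ)).comp tendsto_snd)
  have hH := (((tendsto_scaledHermite ha₀ j).comp hmap).norm).pow 2
  have hS := ((Stirling.tendsto_stirlingSeq_sqrt_pi.pow 2).const_mul 2).comp
    (tendsto_fst (f := (atTop : Filter ℕ)) (g := 𝓝 z₀))
  have hF := (tendsto_factorial_ratio j).comp (tendsto_fst (f := (atTop : Filter ℕ)) (g := 𝓝 z₀))
  have hx : Tendsto (fun p : ℕ × ℂ => (‖p.2‖ ^ 2) ^ j) (atTop ×ˢ 𝓝 z₀) (𝓝 ((‖z₀‖ ^ 2) ^ j)) :=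
    (((tendsto_id.norm).pow 2).pow j).comp tendsto_snd
  have hall := hx.mul ((hH.mul hS).mul hF)
  have h1a : 1 - a₀ ≠ 0 := by
    intro h0
    rw [sub_eq_zero] at h0
    rw [← h0] at ha₀
    simp at ha₀
  -- The limit of the squared contour integral is `(2π)⁻² · 2π/|1 - a₀|`, and twice the square of
  -- Stirling's sequence contributes `2π`.
  have elim : ‖(2 * Real.pi : ℂ)⁻¹ * (Real.pi / ((1 - a₀) / 2)) ^ (1 / 2 : ℂ)‖ ^ 2 *
      (2 * √Real.pi ^ 2) * 1 = ‖1 - a₀‖⁻¹ := by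
    rw [← norm_pow, mul_pow, ← Complex.cpow_nat_mul, Real.sq_sqrt Real.pi_pos.le]
    simp [abs_of_pos Real.pi_pos]
    have := Real.pi_pos
    have : ‖1 - a₀‖ ≠ 0 := by simpa using h1a
    field_simp
  rw [elim] at hall
  refine hall.congr' ?_
  filter_upwards [tendsto_fst.eventually ((eventually_gt_atTop 0).and (eventually_ge_atTop j))]
    with p hp
  obtain ⟨hn, hj⟩ := hp
  have hn' : (0 : ℝ) < p.1 := by exact_mod_cast hn
  rw [momentTerm, if_pos hj]
  simp only [Function.comp, norm_mul, norm_div, Complex.norm_real, Complex.norm_natCast,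
    Complex.norm_exp, Stirling.stirlingSeq, Real.norm_of_nonneg (Real.sqrt_nonneg _),
    Complex.neg_re, Complex.natCast_re]
  set k := p.1 - j with hk
  have hnk : (p.1 : ℝ) ^ p.1 = p.1 ^ k * p.1 ^ j := by rw [← pow_add, hk, Nat.sub_add_cancel hj]
  have hk0 : (k.factorial : ℝ) ≠ 0 := by exact_mod_cast k.factorial_ne_zero
  have hf0 : (p.1.factorial : ℝ) ≠ 0 := by exact_mod_cast p.1.factorial_ne_zero
  have hE : Real.exp 1 ^ p.1 = Real.exp p.1 := by rw [← Real.exp_nat_mul, mul_one]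
  rw [mul_assoc ((‖p.2‖ ^ 2) ^ j)]
  congr 1
  rw [div_pow, div_pow, mul_pow, mul_pow, mul_pow, Real.sq_sqrt hn'.le, Real.sq_sqrt (by positivity),
    div_pow (p.1 : ℝ), hE, Real.exp_neg, pow_add, hnk]
  field_simp

/-- The limiting second moment. -/
def limitMoment (t : ℝ) (z : ℂ) : ℝ := (1 - ‖z‖ ^ 2)⁻¹ * ‖1 - (t : ℂ) * z ^ 2‖⁻¹

lemma norm_mul_sq_lt_one {t : ℝ} (h0 : 0 ≤ t) (h1 : t ≤ 1) {z : ℂ} (hz : ‖z‖ < 1) :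
    ‖(t : ℂ) * z ^ 2‖ < 1 := by
  rw [norm_mul, norm_pow, Complex.norm_real, Real.norm_of_nonneg h0]
  have := norm_nonneg z
  nlinarith [mul_le_mul_of_nonneg_right h1 (sq_nonneg ‖z‖)]

lemma one_sub_mul_sq_ne_zero {t : ℝ} (h0 : 0 ≤ t) (h1 : t ≤ 1) {z : ℂ} (hz : ‖z‖ < 1) :
    1 - (t : ℂ) * z ^ 2 ≠ 0 := by
  intro h
  have := norm_mul_sq_lt_one h0 h1 hz
  rw [← sub_eq_zero.1 h] at this
  simp at this

lemma limitMoment_pos {t : ℝ} (h0 : 0 ≤ t) (h1 : t ≤ 1) {z : ℂ} (hz : ‖z‖ < 1) :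
    0 < limitMoment t z := by
  have h2 := one_sub_mul_sq_ne_zero h0 h1 hz
  have h3 : 0 < 1 - ‖z‖ ^ 2 := by nlinarith [norm_nonneg z]
  unfold limitMoment
  positivity

lemma continuousAt_limitMoment {t : ℝ} (h0 : 0 ≤ t) (h1 : t ≤ 1) {z : ℂ} (hz : ‖z‖ < 1) :
    ContinuousAt (limitMoment t) z := by
  have h2 := one_sub_mul_sq_ne_zero h0 h1 hz
  have h3 : 1 - ‖z‖ ^ 2 ≠ 0 := by nlinarith [norm_nonneg z]
  have h4 : ‖1 - (t : ℂ) * z ^ 2‖ ≠ 0 := by simpa using h2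
  unfold limitMoment
  have c1 : ContinuousAt (fun z : ℂ => 1 - ‖z‖ ^ 2) z := by fun_prop
  have c2 : ContinuousAt (fun z : ℂ => ‖1 - (t : ℂ) * z ^ 2‖) z := by fun_prop
  exact (c1.inv₀ h3).mul (c2.inv₀ h4)

lemma sum_momentTerm_eq_tsum (n : ℕ) (a : ℂ) (x : ℝ) :
    ∑ j ∈ Finset.range (n + 1), momentTerm n a x j = ∑' j, momentTerm n a x j := by
  refine (tsum_eq_sum fun j hj => ?_).symm
  rw [momentTerm, if_neg (by simpa [Nat.lt_succ_iff] using hj)]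

lemma norm_mul_sq_le {t : ℝ} (h0 : 0 ≤ t) (h1 : t ≤ 1) (z : ℂ) :
    ‖(t : ℂ) * z ^ 2‖ ≤ ‖z‖ ^ 2 := by
  rw [norm_mul, norm_pow, Complex.norm_real, Real.norm_of_nonneg h0]
  exact mul_le_of_le_one_left (sq_nonneg _) h1

theorem tendsto_integral_normSq_normCharPoly {t : ℝ} (h0 : 0 ≤ t) (h1 : t ≤ 1) {z₀ : ℂ}
    (hz₀ : ‖z₀‖ < 1) (hne : z₀ ≠ 0) :
    Tendsto (fun p : ℕ × ℂ => ∫ A, ‖normCharPoly p.1 t A p.2‖ ^ 2 ∂(egeLaw p.1 t))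
      (atTop ×ˢ 𝓝 z₀) (𝓝 (limitMoment t z₀)) := by
  have hx₀ : ‖z₀‖ ^ 2 < 1 := by nlinarith [norm_nonneg z₀]
  obtain ⟨x₁, hx₁, hlt⟩ := exists_between hx₀
  have hx₁0 : 0 < x₁ := (sq_nonneg _).trans_lt hx₁
  have hn : ∀ᶠ p : ℕ × ℂ in atTop ×ˢ 𝓝 z₀, 0 < p.1 :=
    tendsto_fst.eventually (eventually_gt_atTop 0)
  have hz : ∀ᶠ p : ℕ × ℂ in atTop ×ˢ 𝓝 z₀, ‖p.2‖ ^ 2 ≤ x₁ ∧ p.2 ≠ 0 :=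
    tendsto_snd.eventually ((((continuous_norm.pow 2).tendsto z₀).eventually
      (eventually_le_nhds hx₁)).and (eventually_ne_nhds hne))
  -- The majorant depends only on `x₁`, chosen strictly between `‖z₀‖²` and 1, so it is valid for
  -- all `z` near `z₀`.
  have h := tendsto_tsum_of_dominated_convergence (𝓕 := (atTop : Filter ℕ) ×ˢ 𝓝 z₀)
    (f := fun p j => momentTerm p.1 (t * p.2 ^ 2) (‖p.2‖ ^ 2) j)
    (summable_momentBound hx₁0.le hlt)
    (fun j => tendsto_momentTerm (norm_mul_sq_lt_one h0 h1 hz₀) j)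
    (by
      filter_upwards [hn, hz] with p hp hp' j
      rw [Real.norm_of_nonneg (momentTerm_nonneg _ _ (sq_nonneg _) _)]
      exact momentTerm_le_momentBound hp (sq_nonneg _) hp'.1 hx₁0 hlt
        ((norm_mul_sq_le h0 h1 _).trans hp'.1) j)
  rw [tsum_mul_right, tsum_geometric_of_lt_one (sq_nonneg _) hx₀] at h
  refine h.congr' ?_
  filter_upwards [hn, hz] with p hp hp'
  rw [integral_normSq_normCharPoly hp (by linarith) h1 hp'.2, sum_momentTerm_eq_tsum]

theorem tendstoUniformlyOn_integral_normSq_normCharPoly {t : ℝ} (h0 : 0 ≤ t) (h1 : t ≤ 1)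
    {K : Set ℂ} (hK : K ⊆ Metric.ball (0 : ℂ) 1 \ {0}) (hc : IsCompact K) :
    TendstoUniformlyOn (fun (n : ℕ) (z : ℂ) => ∫ A, ‖normCharPoly n t A z‖ ^ 2 ∂(egeLaw n t))
      (limitMoment t) atTop K := by
  have ho : IsOpen (Metric.ball (0 : ℂ) 1 \ {0}) := Metric.isOpen_ball.sdiff isClosed_singleton
  -- Uniformity on compact sets reduces to joint convergence as `n → ∞` and `z → z₀` at each point,
  -- given continuity of the limit.
  refine (tendstoLocallyUniformlyOn_iff_forall_isCompact ho).1
    (ho.tendstoLocallyUniformlyOn_iff_forall_tendsto.2 fun z₀ hz₀ => ?_) K hK hc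
  have hz : ‖z₀‖ < 1 := by simpa using hz₀.1
  have hne : z₀ ≠ 0 := by simpa using hz₀.2
  exact (((continuousAt_limitMoment h0 h1 hz).tendsto.comp tendsto_snd).prodMk_nhds
    (tendsto_integral_normSq_normCharPoly h0 h1 hz hne)).mono_right (nhds_le_uniformity _)

end Limit

/-! ### Bounding the expected supremum by second moments on a circle. -/

section Supremum

/-- The value of an entire function on a disc is controlled by its mean square on a larger
circle. -/
lemma enorm_sq_le_lintegral_circle {f : ℂ → ℂ} (hf : Differentiable ℂ f) {r ρ : ℝ} (hr : 0 ≤ r)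
    (hρ : r < ρ) {z : ℂ} (hz : ‖z‖ ≤ r) :
    ‖f z‖ₑ ^ 2 ≤ ENNReal.ofReal (ρ / (2 * Real.pi * (ρ - r))) *
      ∫⁻ θ in Set.Ioc 0 (2 * Real.pi), ‖f (circleMap 0 ρ θ)‖ₑ ^ 2 := by
  have hpi := Real.pi_pos
  have hρ0 : 0 < ρ := by linarith
  have hsub : 0 < ρ - r := by linarith
  -- Applying Cauchy's formula to `f²` rather than `f` yields the mean square directly, without the
  -- Cauchy–Schwarz inequality.
  have hg : Differentiable ℂ fun w => f w ^ 2 := hf.pow 2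
  have hc := (hg.diffContOnCl (s := Metric.ball 0 ρ)).circleIntegral_sub_inv_smul
    (w := z) (by simpa using hz.trans_lt hρ)
  rw [circleIntegral, intervalIntegral.integral_of_le (by positivity)] at hc
  have hval : f z ^ 2 = (2 * Real.pi * Complex.I)⁻¹ *
      ∫ θ in Set.Ioc 0 (2 * Real.pi), deriv (circleMap 0 ρ) θ •
        (circleMap 0 ρ θ - z)⁻¹ • f (circleMap 0 ρ θ) ^ 2 := by
    rw [hc, smul_eq_mul, inv_mul_cancel_left₀]
    simp [hpi.ne']
  have hpt : ∀ θ, ‖deriv (circleMap 0 ρ) θ • (circleMap 0 ρ θ - z)⁻¹ • f (circleMap 0 ρ θ) ^ 2‖ₑ ≤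
      ENNReal.ofReal (ρ / (ρ - r)) * ‖f (circleMap 0 ρ θ)‖ₑ ^ 2 := by
    intro θ
    have hcm : ‖circleMap 0 ρ θ‖ = ρ := by simp [abs_of_pos hρ0]
    have hlow : ρ - r ≤ ‖circleMap 0 ρ θ - z‖ := by
      have := norm_sub_norm_le (circleMap 0 ρ θ) z
      rw [hcm] at this
      linarith
    have h : ‖deriv (circleMap 0 ρ) θ * (circleMap 0 ρ θ - z)⁻¹‖ ≤ ρ / (ρ - r) := by
      rw [deriv_circleMap, norm_mul, norm_mul, norm_inv, hcm, Complex.norm_I, mul_one,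
        ← div_eq_mul_inv]
      gcongr
    rw [smul_smul, smul_eq_mul, enorm_mul, enorm_pow]
    gcongr
    rw [← ofReal_norm]
    exact ENNReal.ofReal_le_ofReal h
  have hconst : ‖(2 * Real.pi * Complex.I)⁻¹‖ₑ = ENNReal.ofReal (2 * Real.pi)⁻¹ := by
    rw [← ofReal_norm]
    congr 1
    simp [abs_of_pos hpi]
  rw [← enorm_pow, hval, enorm_mul, hconst]
  calc _ ≤ ENNReal.ofReal (2 * Real.pi)⁻¹ * ∫⁻ θ in Set.Ioc 0 (2 * Real.pi),
        ENNReal.ofReal (ρ / (ρ - r)) * ‖f (circleMap 0 ρ θ)‖ₑ ^ 2 := by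
        gcongr
        exact (enorm_integral_le_lintegral_enorm _).trans (lintegral_mono hpt)
    _ = _ := by
        rw [lintegral_const_mul' _ _ ENNReal.ofReal_ne_top, ← mul_assoc,
          ← ENNReal.ofReal_mul (by positivity)]
        congr 2
        field_simp

lemma differentiable_normCharPoly (n : ℕ) (t : ℝ) (A : Matrix (Fin n) (Fin n) ℂ) :
    Differentiable ℂ (normCharPoly n t A) := by
  unfold normCharPoly
  simp only [Matrix.det_apply', Matrix.sub_apply, Matrix.smul_apply, smul_eq_mul]
  fun_prop

/-- The second moments are bounded on circles of radius less than one, uniformly in the size. -/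
lemma lintegral_enorm_sq_normCharPoly_le {n : ℕ} (hn : 0 < n) {t : ℝ} (h0 : 0 ≤ t) (h1 : t ≤ 1)
    {z : ℂ} (hz : ‖z‖ < 1) (hne : z ≠ 0) :
    ∫⁻ A, ‖normCharPoly n t A z‖ₑ ^ 2 ∂(egeLaw n t) ≤
      ENNReal.ofReal (∑' j, momentBound (‖z‖ ^ 2) j) := by
  have hx : ‖z‖ ^ 2 < 1 := by nlinarith [norm_nonneg z]
  have hx0 : 0 < ‖z‖ ^ 2 := by positivity
  have hterm : ∀ j, momentTerm n (t * z ^ 2) (‖z‖ ^ 2) j ≤ momentBound (‖z‖ ^ 2) j :=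
    momentTerm_le_momentBound hn hx0.le le_rfl hx0 hx (norm_mul_sq_le h0 h1 z)
  have e : ∀ A, ‖normCharPoly n t A z‖ₑ ^ 2 = ENNReal.ofReal (‖normCharPoly n t A z‖ ^ 2) :=
    fun A => by rw [ENNReal.ofReal_pow (norm_nonneg _), ofReal_norm]
  simp only [e]
  rw [← ofReal_integral_eq_lintegral_ofReal (integrable_normSq_normCharPoly n t z)
    (Eventually.of_forall fun A => sq_nonneg _),
    integral_normSq_normCharPoly hn (by linarith) h1 hne]
  apply ENNReal.ofReal_le_ofReal
  exact (Finset.sum_le_sum fun j _ => hterm j).trans ((summable_momentBound hx0.le hx).sum_le_tsum _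
    fun j _ => (momentTerm_nonneg n _ hx0.le j).trans (hterm j))

/-- The circle bound holds for every matrix and every point of the disc, so it dominates the
supremum. Tonelli's theorem then brings the expectation inside, where the second moment is bounded
independently of `n` and of the angle. -/
theorem lintegral_iSup_normCharPoly_le {t : ℝ} (h0 : 0 ≤ t) (h1 : t ≤ 1) {r ρ : ℝ} (hr : 0 ≤ r)
    (hrρ : r < ρ) (hρ : ρ < 1) {n : ℕ} (hn : 0 < n) :
    ∫⁻ A, (⨆ z ∈ Metric.closedBall (0 : ℂ) r, ‖normCharPoly n t A z‖ₑ ^ 2) ∂(egeLaw n t) ≤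
      ENNReal.ofReal (ρ / (ρ - r) * ∑' j, momentBound (ρ ^ 2) j) := by
  have hpi := Real.pi_pos
  have hρ0 : 0 < ρ := by linarith
  have hsub : 0 < ρ - r := by linarith
  have hmeas : Measurable fun p : Matrix (Fin n) (Fin n) ℂ × ℝ =>
      ‖normCharPoly n t p.1 (circleMap 0 ρ p.2)‖ₑ ^ 2 := by
    have hc : Measurable fun p : Matrix (Fin n) (Fin n) ℂ × ℝ => (p.1, circleMap 0 ρ p.2) :=
      measurable_fst.prodMk ((continuous_circleMap 0 ρ).measurable.comp measurable_snd)
    have e : (fun p : Matrix (Fin n) (Fin n) ℂ × ℝ => normCharPoly n t p.1 (circleMap 0 ρ p.2)) =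
      (fun p : Matrix (Fin n) (Fin n) ℂ × ℂ => normCharPoly n t p.1 p.2) ∘
        fun p => (p.1, circleMap 0 ρ p.2) := rfl
    have hm : Measurable fun p : Matrix (Fin n) (Fin n) ℂ × ℝ =>
        normCharPoly n t p.1 (circleMap 0 ρ p.2) := by
      rw [e]
      exact (measurable_normCharPoly n t).comp hc
    exact hm.enorm.pow_const 2
  calc _ ≤ ∫⁻ A, ENNReal.ofReal (ρ / (2 * Real.pi * (ρ - r))) *
        (∫⁻ θ in Set.Ioc 0 (2 * Real.pi), ‖normCharPoly n t A (circleMap 0 ρ θ)‖ₑ ^ 2)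
          ∂(egeLaw n t) :=
        lintegral_mono fun A => iSup₂_le fun z hz => enorm_sq_le_lintegral_circle
          (differentiable_normCharPoly n t A) hr hrρ (by simpa using hz)
    _ = ENNReal.ofReal (ρ / (2 * Real.pi * (ρ - r))) * ∫⁻ θ in Set.Ioc 0 (2 * Real.pi),
        ∫⁻ A, ‖normCharPoly n t A (circleMap 0 ρ θ)‖ₑ ^ 2 ∂(egeLaw n t) := by
        rw [lintegral_const_mul' _ _ ENNReal.ofReal_ne_top,
          lintegral_lintegral_swap hmeas.aemeasurable]
    _ ≤ ENNReal.ofReal (ρ / (2 * Real.pi * (ρ - r))) * ∫⁻ θ in Set.Ioc 0 (2 * Real.pi),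
        ENNReal.ofReal (∑' j, momentBound (ρ ^ 2) j) := by
        gcongr with θ
        have hcm : ‖circleMap 0 ρ θ‖ = ρ := by simp [abs_of_pos hρ0]
        have h := lintegral_enorm_sq_normCharPoly_le hn h0 h1 (z := circleMap 0 ρ θ)
          (by rwa [hcm]) (circleMap_ne_center hρ0.ne')
        rwa [hcm] at h
    _ = ENNReal.ofReal (ρ / (ρ - r) * ∑' j, momentBound (ρ ^ 2) j) := by
        rw [setLIntegral_const, Real.volume_Ioc, sub_zero,
          mul_comm (ENNReal.ofReal (∑' j, momentBound (ρ ^ 2) j)), ← mul_assoc,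
          ← ENNReal.ofReal_mul (by positivity), ← ENNReal.ofReal_mul (by positivity)]
        congr 2
        field_simp

end Supremum

end EllipticGinibre

end

theorem mainTheorem4 (t : ℝ) (ht0 : 0 < t) (ht1 : t ≤ 1) :
    (∀ n : ℕ, 1 ≤ n → ∀ z ∈ Metric.ball (0 : ℂ) 1,
      Integrable (fun A => ‖EllipticGinibre.normCharPoly n t A z‖ ^ 2)
        (EllipticGinibre.egeLaw n t)) ∧
    (∃ F : ℂ → ℝ,
      ContinuousOn F (Metric.ball (0 : ℂ) 1 \ {0}) ∧
      (∀ z ∈ Metric.ball (0 : ℂ) 1 \ {0}, 0 < F z) ∧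
      ∀ K : Set ℂ, K ⊆ Metric.ball (0 : ℂ) 1 \ {0} → IsCompact K →
        TendstoUniformlyOn
          (fun (n : ℕ) (z : ℂ) =>
            ∫ A, ‖EllipticGinibre.normCharPoly n t A z‖ ^ 2 ∂(EllipticGinibre.egeLaw n t))
          F atTop K) ∧
    (∀ r : ℝ, 0 ≤ r → r < 1 → ∃ C : ℝ, 0 < C ∧ ∀ n : ℕ, 1 ≤ n →
      ∫⁻ A, (⨆ z ∈ Metric.closedBall (0 : ℂ) r, ‖EllipticGinibre.normCharPoly n t A z‖ₑ ^ 2)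
        ∂(EllipticGinibre.egeLaw n t) ≤ ENNReal.ofReal C) := by
  refine ⟨fun n _ z _ => EllipticGinibre.integrable_normSq_normCharPoly n t z,
    ⟨EllipticGinibre.limitMoment t, fun z hz => ?_, fun z hz => ?_, fun K hK hc =>
      EllipticGinibre.tendstoUniformlyOn_integral_normSq_normCharPoly ht0.le ht1 hK hc⟩,
    fun r hr hr1 => ?_⟩
  · exact (EllipticGinibre.continuousAt_limitMoment ht0.le ht1
      (by simpa using hz.1)).continuousWithinAt
  · exact EllipticGinibre.limitMoment_pos ht0.le ht1 (by simpa using hz.1)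
  · obtain ⟨ρ, hrρ, hρ⟩ := exists_between hr1
    -- The maximum with 1 gives positivity of the constant without inspecting the series.
    refine ⟨max 1 (ρ / (ρ - r) * ∑' j, EllipticGinibre.momentBound (ρ ^ 2) j),
      lt_max_of_lt_left one_pos, fun n hn =>
      (EllipticGinibre.lintegral_iSup_normCharPoly_le ht0.le ht1 hr hrρ hρ hn).trans
        (ENNReal.ofReal_le_ofReal (le_max_right _ _))⟩
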